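/- Let $\mathcal E$ be an oriented three-dimensional Euclidean affine space, identified with its translation space $E$ by the choice of an origin, with Euclidean metric $q: E\to E^\star$ and volume form $\mathrm{vol}_q$. Let $\mathcal B$ (the body) be a smooth compact three-dimensional manifold with boundary, equipped with a volume form $\mu$ (the mass form), which also orients $\mathcal B$. Let $p_0,p:\mathcal B\to\mathcal E$ be two smooth orientation-preserving embeddings, with tangent maps $F_0=Tp_0$ and $F=Tp$. Put $\Omega_{p}=p(\mathcal B)$, $\Omega_0=p_0(\mathcal B)$, $\partial\Omega_p=p(\partial\mathcal B)$, $\partial\Omega_0=p_0(\partial\mathcal B)$. Let $n$ be the outer unit normal and $da$ the Euclidean area element on $\partial\Omega_p$, and $da_0$ the area element on $\partial\Omega_0$. Let $\gamma_0=p_0^*q=F_0^\star qF_0$ be the reference metric on $\mathcal B$, $N_0$ the outer unit normal on $\partial\mathcal B$ for $\gamma_0$, and $da_{\gamma_0}=p_0^*\,da_0$ the corresponding area element on $\partial\mathcal B$. The mass densities $\rho$ on $\Omega_p$ and $\rho_0$ on $\Omega_0$ are defined by $p_*\mu=\rho\,\mathrm{vol}_q$ and ${p_0}_*\mu=\rho_0\,\mathrm{vol}_q$,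 and $\rho_{\gamma_0}=\rho_0\circ p_0$. Let $\sigma$ be a continuous (in particular, a smooth) symmetric contravariant second-order tensor field on $\Omega_p$, regarded as a field of maps $E^\star\to E$, and let $\hat\sigma=\sigma q$, $\tau=\sigma/\rho$ and $\theta=p^*\tau=F^{-1}(\tau\circ p)F^{-\star}$, where $F^{\star}$ denotes the (metric-free) transpose of $F$ and $F^{-\star}=(F^{-1})^\star$. Define on $\mathcal B$ the mixed stress tensor with values in $E$ (first Piola–Kirchhoff tensor on the body) $$\hat\pi:=\rho_{\gamma_0}\,(\tau\circ p)\,F^{-\star}\gamma_0 .$$ Then $$\hat\pi=\rho_{\gamma_0}\,F\,\theta\,\gamma_0$$ at every point of $\mathcal B$, and for every smooth $\delta p:\mathcal B\to E$, with $w=\delta p\circ p^{-1}$ on $\Omega_p$, both integrands below are integrable and $$\int_{\partial\Omega_p}(\hat\sigma n\cdot w)\,da=\int_{\partial\mathcal B}(\hat\pi N_0\cdot\delta p)\,da_{\gamma_0}.$$ -/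

import Mathlib

open scoped Manifold ContDiff InnerProductSpace MeasureTheory

noncomputable section

/-- The metric-free transpose `A⋆ : W⋆ → V⋆`, `α ↦ α ∘ A`, of a linear map `A : V → W`. -/
def transposeMap {V W : Type*} [AddCommGroup V] [Module ℝ V] [TopologicalSpace V]
    [IsTopologicalAddGroup V] [ContinuousSMul ℝ V]
    [AddCommGroup W] [Module ℝ W] [TopologicalSpace W]
    [IsTopologicalAddGroup W] [ContinuousSMul ℝ W] (A : V →L[ℝ] W) :
    (W →L[ℝ] ℝ) →L[ℝ] (V →L[ℝ] ℝ) :=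
  ContinuousLinearMap.precomp ℝ A

/-- The Euclidean metric, as a map `q : E → E⋆`. -/
def euclideanMetric (E : Type*) [NormedAddCommGroup E] [InnerProductSpace ℝ E] :
    E →L[ℝ] (E →L[ℝ] ℝ) :=
  innerSL ℝ

section Normal

variable {V : Type*} [AddCommGroup V] [Module ℝ V] [TopologicalSpace V]

/-- `A` is the inclusion, into a space `V` with inner product `b`, of the tangent space at a
boundary point of a 3-manifold with boundary; a tangent vector `v` is represented by its
coordinates in the preferred chart at that point, which has values in the half-space `0 ≤ y 0`.
So the tangent space to the boundary is `v 0 = 0` and the outward vectors are those with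
`v 0 < 0`. The vector `N` is the outer unit normal if it is a unit vector, orthogonal to the
boundary, and on the outward side. -/
def IsOuterUnitNormal (b : V →L[ℝ] (V →L[ℝ] ℝ)) (A : EuclideanSpace ℝ (Fin 3) →L[ℝ] V)
    (N : V) : Prop :=
  b N N = 1 ∧ (∀ v : EuclideanSpace ℝ (Fin 3), v 0 = 0 → b N (A v) = 0) ∧
    ∀ v : EuclideanSpace ℝ (Fin 3), v 0 < 0 → 0 < b N (A v)

/-- The outer unit normal. -/
def outerUnitNormal (b : V →L[ℝ] (V →L[ℝ] ℝ)) (A : EuclideanSpace ℝ (Fin 3) →L[ℝ] V) : V :=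
  Classical.epsilon (IsOuterUnitNormal b A)

end Normal

/-- Existence and uniqueness of the outer unit normal for a positive definite `b`. -/
theorem existsUnique_isOuterUnitNormal {V : Type*} [AddCommGroup V] [Module ℝ V]
    [TopologicalSpace V] (b : V →L[ℝ] (V →L[ℝ] ℝ))
    (hpos : ∀ u, u ≠ 0 → 0 < b u u)
    (A : EuclideanSpace ℝ (Fin 3) →L[ℝ] V) (hA : Function.Bijective A) :
    ∃! N, IsOuterUnitNormal b A N := by
  have e : EuclideanSpace ℝ (Fin 3) ≃ₗ[ℝ] V := LinearEquiv.ofBijective A.toLinearMap hA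
  have he : FiniteDimensional ℝ V := e.finiteDimensional
  -- the linear form `v ↦ b u (A v)` determines `u`
  let L : V →ₗ[ℝ] Module.Dual ℝ (EuclideanSpace ℝ (Fin 3)) :=
    { toFun := fun u => (b u).toLinearMap.comp A.toLinearMap
      map_add' := by intros; ext; simp
      map_smul' := by intros; ext; simp }
  have hL : Function.Injective L := by
    rw [injective_iff_map_eq_zero]
    intro u hu
    by_contra h
    obtain ⟨v, hv⟩ := hA.2 u
    have h1 := hpos u h
    have h2 : b u (A v) = 0 := LinearMap.congr_fun hu v
    rw [hv] at h2
    exact h1.ne' h2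
  have hs : Function.Surjective L := by
    refine (LinearMap.injective_iff_surjective_of_finrank_eq_finrank ?_).1 hL
    rw [Subspace.dual_finrank_eq, e.finrank_eq]
  let ℓ : Module.Dual ℝ (EuclideanSpace ℝ (Fin 3)) :=
    -(EuclideanSpace.proj (0 : Fin 3) : EuclideanSpace ℝ (Fin 3) →L[ℝ] ℝ).toLinearMap
  have hℓ : ∀ v, ℓ v = - v 0 := fun v => rfl
  obtain ⟨N', hN'⟩ := hs ℓ
  have hbN' : ∀ v, b N' (A v) = - v 0 := fun v => by
    rw [← hℓ, ← hN']; rfl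
  have hN0 : N' ≠ 0 := by
    rintro rfl
    have := hbN' (EuclideanSpace.single 0 1)
    simp at this
  have hp := hpos N' hN0
  have hsq : 0 < Real.sqrt (b N' N') := Real.sqrt_pos.2 hp
  have hss := Real.mul_self_sqrt hp.le
  refine ⟨(Real.sqrt (b N' N'))⁻¹ • N', ⟨?_, ?_, ?_⟩, ?_⟩
  · simp only [map_smul, smul_apply, smul_eq_mul]
    field_simp
    nlinarith
  · intro v hv
    simp [hbN', hv]
  · intro v hv
    simp only [map_smul, smul_apply, smul_eq_mul, hbN']
    exact mul_pos (inv_pos.2 hsq) (by linarith)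
  · rintro M ⟨h1, h2, h3⟩
    set c := b M (A (-EuclideanSpace.single 0 1)) with hc
    have hcpos : 0 < c := h3 _ (by simp)
    have hM : M = c • N' := by
      apply hL
      refine LinearMap.ext fun v => ?_
      change b M (A v) = b (c • N') (A v)
      have h4 := h2 (v + v 0 • (-EuclideanSpace.single 0 1)) (by simp)
      simp only [map_add, map_smul, smul_eq_mul] at h4
      rw [← hc] at h4
      simp only [map_smul, smul_apply, smul_eq_mul, hbN']
      linarith
    have h5 : c * (c * b N' N') = 1 := by
      rw [hM] at h1
      simpa using h1
    have h6 : c = (Real.sqrt (b N' N'))⁻¹ := by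
      refine eq_inv_of_mul_eq_one_left ?_
      have : (c * Real.sqrt (b N' N')) * (c * Real.sqrt (b N' N')) = 1 := by
        calc _ = c * (c * (Real.sqrt (b N' N') * Real.sqrt (b N' N'))) := by ring
          _ = 1 := by rw [hss, h5]
      nlinarith [mul_pos hcpos hsq]
    rw [hM, h6]

section Body

variable (B : Type*) [TopologicalSpace B] [ChartedSpace (EuclideanHalfSpace 3) B]
  [IsManifold (𝓡∂ 3) ∞ B]

/-- A volume form on the 3-manifold with boundary `B`: a smooth 3-form that vanishes nowhere.
Smoothness is that of its coefficient in the coordinate frame of each chart. -/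
structure VolumeForm where
  toForm : ∀ x : B, (TangentSpace (𝓡∂ 3) x) [⋀^Fin 3]→ₗ[ℝ] ℝ
  ne_zero : ∀ x, toForm x ≠ 0
  smooth : ∀ c : B, ContMDiffOn (𝓡∂ 3) 𝓘(ℝ, ℝ) ∞
    (fun x => toForm x fun i =>
      (trivializationAt (EuclideanSpace ℝ (Fin 3)) (TangentSpace (𝓡∂ 3)) c).symm x
        (EuclideanSpace.single i 1))
    (chartAt (EuclideanHalfSpace 3) c).source

variable {B}
variable {E : Type*} [NormedAddCommGroup E] [InnerProductSpace ℝ E]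

/-- The linear tangent map `F = Tp` at `x`. -/
def tangentF (p : B → E) (x : B) : TangentSpace (𝓡∂ 3) x →L[ℝ] E :=
  mfderiv (𝓡∂ 3) 𝓘(ℝ, E) p x

/-- The map `F⁻¹ : E → T_x B`. -/
def tangentFInv (p : B → E) (x : B) : E →L[ℝ] TangentSpace (𝓡∂ 3) x :=
  (tangentF p x).inverse

/-- The map `F⁻⋆ : T_x⋆ B → E⋆`. -/
def tangentFInvStar (p : B → E) (x : B) :
    (TangentSpace (𝓡∂ 3) x →L[ℝ] ℝ) →L[ℝ] (E →L[ℝ] ℝ) :=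
  transposeMap (tangentFInv p x)

/-- The metric `p^* q = F⋆ q F` on the body. -/
def bodyMetric (p : B → E) (x : B) :
    TangentSpace (𝓡∂ 3) x →L[ℝ] (TangentSpace (𝓡∂ 3) x →L[ℝ] ℝ) :=
  (transposeMap (tangentF p x)).comp ((euclideanMetric E).comp (tangentF p x))

/-- The boundary `∂B` of the body. -/
def bodyBoundary (B : Type*) [TopologicalSpace B] [ChartedSpace (EuclideanHalfSpace 3) B] :
    Set B :=
  (𝓡∂ 3).boundary B

/-- The outer unit normal on `∂B` for the metric `p^* q`. -/
def bodyNormal (p : B → E) (x : B) : TangentSpace (𝓡∂ 3) x :=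
  outerUnitNormal (V := TangentSpace (𝓡∂ 3) x) (bodyMetric p x)
    (ContinuousLinearMap.id ℝ (TangentSpace (𝓡∂ 3) x))

/-- The Euclidean outer unit normal on `∂Ω_p = p(∂B)`, as a function on space. -/
def spaceNormal (p : B → E) : E → E :=
  Function.extend p (fun x => outerUnitNormal (euclideanMetric E) (tangentF p x)) 0

/-- The area measure on `∂Ω_p = p(∂B)`: the two-dimensional Hausdorff measure of Euclidean
space, normalized to be the area. -/
def spaceArea [MeasurableSpace E] [BorelSpace E] (p : B → E) : MeasureTheory.Measure E :=
  (μHE[2] : MeasureTheory.Measure E).restrict (p '' bodyBoundary B)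

/-- The area measure `da_γ = p^* da` on `∂B` of the metric `γ = p^* q`. -/
def bodyArea [MeasurableSpace B] [MeasurableSpace E] [BorelSpace E] (p : B → E) :
    MeasureTheory.Measure B :=
  (spaceArea p).comap p

variable [Fact (Module.finrank ℝ E = 3)]

/-- A configuration: a smooth embedding of the body in the oriented space `E` that preserves
orientation, the body being oriented by its mass form `μ`. -/
structure IsConfiguration (o : Orientation ℝ E (Fin 3)) (μ : VolumeForm B) (p : B → E) :
    Prop where
  smooth : ContMDiff (𝓡∂ 3) 𝓘(ℝ, E) ∞ p
  isEmbedding : Topology.IsEmbedding p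
  immersion : ∀ x, Function.Injective (tangentF p x)
  orientation : ∀ x (v : Fin 3 → TangentSpace (𝓡∂ 3) x), 0 < μ.toForm x v →
    0 < o.volumeForm fun i => tangentF p x (v i)

/-- The mass density `ρ = p_* μ / vol_q` on `Ω_p = p(B)`: at `p x` it is the quotient of the
values of `μ` and of `p^* vol_q` on a basis of `T_x B`. -/
def massDensity (o : Orientation ℝ E (Fin 3)) (μ : VolumeForm B) (p : B → E) : E → ℝ :=
  Function.extend p
    (fun x =>
      let e : Fin 3 → TangentSpace (𝓡∂ 3) x := fun i => EuclideanSpace.single i (1 : ℝ)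
      μ.toForm x e / o.volumeForm fun i => tangentF p x (e i)) 0

/-- The Kirchhoff stress `τ = σ / ρ` on `Ω_p`. -/
def kirchhoffStress (o : Orientation ℝ E (Fin 3)) (μ : VolumeForm B) (p : B → E)
    (σ : E → (E →L[ℝ] ℝ) →L[ℝ] E) (y : E) : (E →L[ℝ] ℝ) →L[ℝ] E :=
  (massDensity o μ p y)⁻¹ • σ y

/-- The pullback `p^* t = F⁻¹ (t ∘ p) F⁻⋆` of a second-order contravariant tensor field. -/
def pullbackContravariant (p : B → E) (t : E → (E →L[ℝ] ℝ) →L[ℝ] E) (x : B) :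
    (TangentSpace (𝓡∂ 3) x →L[ℝ] ℝ) →L[ℝ] TangentSpace (𝓡∂ 3) x :=
  (tangentFInv p x).comp ((t (p x)).comp (tangentFInvStar p x))

/-- The first Piola–Kirchhoff tensor on the body, `ρ_γ₀ (τ ∘ p) F⁻⋆ γ₀`, where `γ₀ = p₀^* q` and
`ρ_γ₀ = ρ₀ ∘ p₀`. -/
def firstPiolaKirchhoff (o : Orientation ℝ E (Fin 3)) (μ : VolumeForm B) (p₀ p : B → E)
    (σ : E → (E →L[ℝ] ℝ) →L[ℝ] E) (x : B) : TangentSpace (𝓡∂ 3) x →L[ℝ] E :=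
  massDensity o μ p₀ (p₀ x) •
    (kirchhoffStress o μ p σ (p x)).comp ((tangentFInvStar p x).comp (bodyMetric p₀ x))

end Body

end

/-! The first identity is `F F⁻¹ = 1`. The second is Nanson's formula: both sides become integrals
over the boundary of the body, and three ratios must match.

Let `A`, `A₀` be the tangent maps of `p`, `p₀` in a boundary chart, and let `conormal A` represent
the form `-dy⁰ ∘ A⁻¹`. The outer normal is `conormal A` normalized, and `A` scales area on the plane
`v 0 = 0` by `areaFactor`, which is `|det A| * ‖conormal A‖` (`normDet_planeInclusion`). The
quotient of the mass densities is `|det A| / |det A₀|` (`massDensity_div`), while `F⁻⋆ γ₀ N₀` is `q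
n` times the quotient of the conormal norms (`tangentFInvStar_bodyMetric_bodyNormal`). Hence
`firstPiolaKirchhoff_bodyNormal`: the Piola traction is the Cauchy traction times `areaDensity`.

The same function must be the density of one boundary area with respect to the other
(`bodyArea_eq_withDensity`). As area is a Hausdorff measure, this is shown by comparison: near each
point an embedding is bi-Lipschitz to its linearization with constant `r` as close to 1 as desired,
so the two measures agree locally up to a power of `r`. Compactness makes the bound global, and `r →
1` gives equality.

Tangent maps are read in a preferred chart that varies with the point, so continuity is not
automatic. `tangentCoordChange_zero` supplies it: at boundary points a coordinate change multiplies
the form `dy⁰` by a positive constant, which changes neither normals nor quotients of area factors.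
-/

noncomputable section

open MeasureTheory Set Filter Topology ContinuousLinearMap

local notation "ℝ²" => EuclideanSpace ℝ (Fin 2)
local notation "ℝ³" => EuclideanSpace ℝ (Fin 3)

/-! ### Linear algebra: volume, conormals and area factors. -/

section Linear

variable {E : Type*} [NormedAddCommGroup E] [InnerProductSpace ℝ E]

theorem euclideanMetric_apply (u v : E) : euclideanMetric E u v = ⟪u, v⟫_ℝ := rfl

theorem euclideanMetric_pos (u : E) (hu : u ≠ 0) : 0 < euclideanMetric E u u := by
  simpa [euclideanMetric_apply, sq_pos_iff] using hu

section Volume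

variable [Fact (Module.finrank ℝ E = 3)] (o : Orientation ℝ E (Fin 3))

/-- The pullback of the volume form is a 3-form on `ℝ³`, hence a multiple of the determinant. -/
theorem volumeForm_comp (A : ℝ³ →L[ℝ] E) (v : Fin 3 → ℝ³) :
    (o.volumeForm fun i => A (v i)) =
      (o.volumeForm fun i => A (EuclideanSpace.single i 1)) *
        (EuclideanSpace.basisFun (Fin 3) ℝ).toBasis.det v := by
  have h := AlternatingMap.eq_smul_basis_det (EuclideanSpace.basisFun (Fin 3) ℝ).toBasis
    (o.volumeForm.compLinearMap A.toLinearMap)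
  have h2 := congrArg (fun f => f v) h
  simpa [Function.comp_def] using h2

theorem volumeForm_ne_zero {A : ℝ³ →L[ℝ] E} (hA : A.IsInvertible) :
    (o.volumeForm fun i => A (EuclideanSpace.single i 1)) ≠ 0 := by
  obtain ⟨e, rfl⟩ := hA
  have : FiniteDimensional ℝ E := .of_fact_finrank_eq_succ 2
  let b := (stdOrthonormalBasis ℝ E).reindex
    (finCongr (Fact.out : Module.finrank ℝ E = 3))
  intro h
  have h1 := volumeForm_comp o (e : ℝ³ →L[ℝ] E) fun i => e.symm (b i)
  rw [h, zero_mul] at h1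
  have h2 := o.abs_volumeForm_apply_of_orthonormal b
  simp only [ContinuousLinearEquiv.coe_coe, ContinuousLinearEquiv.apply_symm_apply] at h1
  rw [show (⇑b : Fin 3 → E) = fun i => b i from rfl, h1] at h2
  simp at h2

/-- If `M` is the matrix of `v` in an orthonormal basis, the volume is `± det M` and the Gram matrix
is `Mᵀ M`. -/
theorem volumeForm_sq_eq_det_gram (v : Fin 3 → E) :
    o.volumeForm v ^ 2 = (Matrix.gram ℝ v).det := by
  have : FiniteDimensional ℝ E := .of_fact_finrank_eq_succ 2
  let b := (stdOrthonormalBasis ℝ E).reindex (finCongr (Fact.out : Module.finrank ℝ E = 3))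
  rw [← sq_abs, o.volumeForm_robust' b, sq_abs, Matrix.gram_eq_conjTranspose_mul b, Matrix.det_mul,
    Matrix.det_conjTranspose, Module.Basis.det_apply, sq]
  rfl

end Volume

variable [CompleteSpace E]

/-- The vector representing the linear form `v ↦ -(A⁻¹ v) 0`: an outward normal to the image under
`A` of the hyperplane `v 0 = 0`. -/
def conormal (A : ℝ³ →L[ℝ] E) : E :=
  (InnerProductSpace.toDual ℝ E).symm (-((EuclideanSpace.proj (0 : Fin 3)).comp A.inverse))

theorem isInvertible_of_bijective {V : Type*} [NormedAddCommGroup V] [NormedSpace ℝ V]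
    [CompleteSpace V] {A : V →L[ℝ] E} (h : Function.Bijective A) : A.IsInvertible :=
  ⟨ContinuousLinearEquiv.ofBijective A (LinearMap.ker_eq_bot.2 h.1) (LinearMap.range_eq_top.2 h.2),
    rfl⟩

theorem inner_conormal_left (A : ℝ³ →L[ℝ] E) (u : E) :
    ⟪conormal A, u⟫_ℝ = -(A.inverse u) 0 := by
  rw [conormal, InnerProductSpace.toDual_symm_apply]
  rfl

theorem inner_conormal {A : ℝ³ →L[ℝ] E} (hA : A.IsInvertible) (v : ℝ³) :
    ⟪conormal A, A v⟫_ℝ = -v 0 := by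
  rw [inner_conormal_left, hA.inverse_apply_self]

theorem conormal_ne_zero {A : ℝ³ →L[ℝ] E} (hA : A.IsInvertible) : conormal A ≠ 0 := by
  intro h
  have := inner_conormal hA (EuclideanSpace.single 0 1)
  simp [h] at this

theorem isOuterUnitNormal_conormal {A : ℝ³ →L[ℝ] E} (hA : A.IsInvertible) :
    IsOuterUnitNormal (euclideanMetric E) A (‖conormal A‖⁻¹ • conormal A) := by
  have hpos := norm_pos_iff.2 (conormal_ne_zero hA)
  refine ⟨?_, fun v hv => ?_, fun v hv => ?_⟩
  · simp only [euclideanMetric_apply, inner_smul_left, inner_smul_right,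
      real_inner_self_eq_norm_sq, conj_trivial]
    field_simp
  · simp [euclideanMetric_apply, inner_conormal hA, hv]
  · simp only [euclideanMetric_apply, inner_smul_left, conj_trivial,
      inner_conormal hA]
    exact mul_pos (inv_pos.2 hpos) (by linarith)

/-- Uniqueness turns the normal obtained by choice into a formula that is visibly continuous in `A`.
-/
theorem outerUnitNormal_eq {A : ℝ³ →L[ℝ] E} (hA : A.IsInvertible) :
    outerUnitNormal (euclideanMetric E) A = ‖conormal A‖⁻¹ • conormal A := by
  have h := existsUnique_isOuterUnitNormal (euclideanMetric E) euclideanMetric_pos A hA.bijective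
  exact h.unique (Classical.epsilon_spec h.exists) (isOuterUnitNormal_conormal hA)

theorem conormal_comp {A : ℝ³ →L[ℝ] E} (hA : A.IsInvertible) {C : ℝ³ →L[ℝ] ℝ³}
    (hC : C.IsInvertible) {c : ℝ} (hc : 0 < c) (h0 : ∀ v, (C v) 0 = c * v 0) :
    conormal (A.comp C) = c⁻¹ • conormal A := by
  refine ext_inner_right ℝ fun u => ?_
  obtain ⟨w, rfl⟩ := hA.bijective.2 u
  obtain ⟨v, rfl⟩ := hC.bijective.2 w
  have h1 := inner_conormal (hA.comp hC) v
  rw [ContinuousLinearMap.comp_apply] at h1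
  rw [h1, inner_smul_left, inner_conormal hA, h0]
  simp [hc.ne']

theorem outerUnitNormal_comp {A : ℝ³ →L[ℝ] E} (hA : A.IsInvertible) {C : ℝ³ →L[ℝ] ℝ³}
    (hC : C.IsInvertible) {c : ℝ} (hc : 0 < c) (h0 : ∀ v, (C v) 0 = c * v 0) :
    outerUnitNormal (euclideanMetric E) (A.comp C) = outerUnitNormal (euclideanMetric E) A := by
  rw [outerUnitNormal_eq hA, outerUnitNormal_eq (hA.comp hC), conormal_comp hA hC hc h0, norm_smul,
    smul_smul, norm_inv, Real.norm_of_nonneg hc.le]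
  congr 1
  field_simp

variable [Fact (Module.finrank ℝ E = 3)] (o : Orientation ℝ E (Fin 3))

/-- The area factor of the restriction of `A` to the hyperplane `v 0 = 0`. -/
def areaFactor (A : ℝ³ →L[ℝ] E) : ℝ :=
  |o.volumeForm fun i => A (EuclideanSpace.single i 1)| * ‖conormal A‖

theorem areaFactor_pos {A : ℝ³ →L[ℝ] E} (hA : A.IsInvertible) : 0 < areaFactor o A :=
  mul_pos (abs_pos.2 (volumeForm_ne_zero o hA)) (norm_pos_iff.2 (conormal_ne_zero hA))

theorem areaFactor_comp {A : ℝ³ →L[ℝ] E} (hA : A.IsInvertible) {C : ℝ³ →L[ℝ] ℝ³}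
    (hC : C.IsInvertible) {c : ℝ} (hc : 0 < c) (h0 : ∀ v, (C v) 0 = c * v 0) :
    areaFactor o (A.comp C) =
      |(EuclideanSpace.basisFun (Fin 3) ℝ).toBasis.det fun i => C (EuclideanSpace.single i 1)| *
        c⁻¹ * areaFactor o A := by
  simp only [areaFactor, ContinuousLinearMap.comp_apply]
  rw [volumeForm_comp, conormal_comp hA hC hc h0, norm_smul, norm_inv, Real.norm_of_nonneg hc.le,
    abs_mul]
  ring

/-- The coordinate change contributes `|det C| / c` to both factors, and this cancels; the quotient
is therefore independent of the chart. -/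
theorem areaFactor_div_comp {A A₀ : ℝ³ →L[ℝ] E} (hA : A.IsInvertible) (hA₀ : A₀.IsInvertible)
    {C : ℝ³ →L[ℝ] ℝ³} (hC : C.IsInvertible) {c : ℝ} (hc : 0 < c)
    (h0 : ∀ v, (C v) 0 = c * v 0) :
    areaFactor o (A.comp C) / areaFactor o (A₀.comp C) = areaFactor o A / areaFactor o A₀ := by
  have h1 := areaFactor_pos o (hA.comp hC)
  rw [areaFactor_comp o hA hC hc h0] at h1 ⊢
  rw [areaFactor_comp o hA₀ hC hc h0]
  refine mul_div_mul_left _ _ fun h => ?_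
  simp [h] at h1

/-- The inclusion of the plane as the hyperplane `v 0 = 0`. -/
def planeInclusion : ℝ² →L[ℝ] ℝ³ :=
  LinearMap.toContinuousLinearMap
    { toFun := fun v => !₂[0, v 0, v 1]
      map_add' := fun v w => by ext i; fin_cases i <;> simp
      map_smul' := fun c v => by ext i; fin_cases i <;> simp }

theorem planeInclusion_apply (v : ℝ²) : planeInclusion v = !₂[0, v 0, v 1] := rfl

theorem range_planeInclusion : range planeInclusion = {v : ℝ³ | v 0 = 0} := by
  ext v
  refine ⟨?_, fun h => ⟨!₂[v 1, v 2], ?_⟩⟩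
  · rintro ⟨w, rfl⟩
    simp [planeInclusion_apply]
  · rw [planeInclusion_apply]
    ext i
    fin_cases i <;> simp_all

theorem norm_planeInclusion (v : ℝ²) : ‖planeInclusion v‖ = ‖v‖ := by
  simp [EuclideanSpace.norm_eq, planeInclusion_apply, Fin.sum_univ_succ]

theorem planeInclusion_basis (i : Fin 2) :
    planeInclusion (EuclideanSpace.single i 1) = EuclideanSpace.single i.succ 1 := by
  rw [planeInclusion_apply]
  ext j
  fin_cases i <;> fin_cases j <;> simp

/-- Compute the squared volume spanned by the conormal `m` and the images `t` of the two plane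
vectors in two ways. Since `m` is orthogonal to `t`, it is `‖m‖²` times the Gram determinant of `t`.
Writing `m = A u` with `u 0 = -‖m‖²`, it is also `‖m‖⁴ (det A)²`. -/
theorem normDet_planeInclusion {A : ℝ³ →L[ℝ] E} (hA : A.IsInvertible) :
    (A.comp planeInclusion).toLinearMap.normDet = areaFactor o A := by
  set m := conormal A with hm
  have hm0 := norm_pos_iff.2 (conormal_ne_zero hA)
  rw [← hm] at hm0
  let e : Fin 3 → ℝ³ := fun i => EuclideanSpace.single i 1
  let t : Fin 2 → E := fun i => A (e i.succ)
  have hmt (i : Fin 2) : ⟪m, t i⟫_ℝ = 0 := by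
    simp only [t, e]; rw [inner_conormal hA]; simp
  have hgram : (Matrix.gram ℝ (Matrix.vecCons m t)).det = ‖m‖ ^ 2 * (Matrix.gram ℝ t).det := by
    rw [Matrix.det_succ_row_zero, Fin.sum_univ_succ]
    simp only [Matrix.gram_apply, Matrix.cons_val_zero, Matrix.cons_val_succ, hmt]
    simp only [Fin.val_zero, pow_zero, real_inner_self_eq_norm_sq, mul_zero, zero_mul,
      Finset.sum_const_zero, add_zero, one_mul]
    rfl
  have hnd : (A.comp planeInclusion).toLinearMap.normDet ^ 2 = (Matrix.gram ℝ t).det := by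
    have := (A.comp planeInclusion).toLinearMap.normDet_sq_eq_det_gram
      (EuclideanSpace.basisFun (Fin 2) ℝ)
    rw [RCLike.ofReal_real_eq_id, id] at this
    rw [this]
    congr 2
    ext i : 1
    simp [planeInclusion_basis, t, e]
  obtain ⟨u, hu⟩ := hA.bijective.2 m
  have hu0 : ‖m‖ ^ 2 = -u 0 := by
    rw [← inner_conormal hA, hu, real_inner_self_eq_norm_sq]
  have hvol : o.volumeForm (Matrix.vecCons m t) = u 0 * o.volumeForm fun i => A (e i) := by
    have h1 : Matrix.vecCons m t = fun i => A (Matrix.vecCons u (fun j : Fin 2 => e j.succ) i) := by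
      ext i : 1
      refine Fin.cases ?_ (fun j => ?_) i <;> simp [hu, t]
    rw [h1, volumeForm_comp, mul_comm]
    congr 1
    rw [Module.Basis.det_apply, Matrix.det_fin_three]
    simp [Module.Basis.toMatrix_apply, e]
  have h3 := volumeForm_sq_eq_det_gram o (Matrix.vecCons m t)
  rw [hgram, hvol, ← hnd] at h3
  rw [← sq_eq_sq₀ (LinearMap.normDet_nonneg _) (areaFactor_pos o hA).le, areaFactor, mul_pow, sq_abs]
  refine mul_left_cancel₀ (pow_pos hm0 2).ne' ?_
  rw [← h3, ← hm]
  have : u 0 = - ‖m‖ ^ 2 := by linarith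
  rw [this]
  ring

theorem euclideanHausdorffMeasure_image_hyperplane [MeasurableSpace E] [BorelSpace E]
    {A : ℝ³ →L[ℝ] E} (hA : A.IsInvertible) {s : Set ℝ³} (hs : ∀ v ∈ s, v 0 = 0) :
    (μHE[2] : Measure E) (A '' s) =
      ENNReal.ofReal (areaFactor o A) * volume (planeInclusion ⁻¹' s) := by
  have h := (A.comp planeInclusion).toLinearMap.euclideanHausdorffMeasure_image_eq_normDet_mul_volume
    (planeInclusion ⁻¹' s)
  rw [finrank_euclideanSpace_fin, normDet_planeInclusion o hA] at h
  rw [← h]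
  congr 1
  simp only [ContinuousLinearMap.coe_coe, ContinuousLinearMap.coe_comp, image_comp]
  rw [image_preimage_eq_of_subset]
  rw [range_planeInclusion]
  exact hs

end Linear

/-! ### Hausdorff measure under comparison of distances. -/

section Comparison

variable {X Y Z : Type*} [EMetricSpace X] [MeasurableSpace X] [BorelSpace X]
  [EMetricSpace Y] [MeasurableSpace Y] [BorelSpace Y]

/-- The assignment `g z ↦ f z` is well defined and `K`-Lipschitz on `g '' s`. No injectivity is
needed: the bound forces `f` to be constant on the fibres of `g` in `s`. -/
theorem euclideanHausdorffMeasure_image_le_of_edist_le {f : Z → X} {g : Z → Y} {s : Set Z}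
    {K : NNReal} (d : ℕ) (h : ∀ y ∈ s, ∀ z ∈ s, edist (f y) (f z) ≤ K * edist (g y) (g z)) :
    (μHE[d] : Measure X) (f '' s) ≤ K ^ d * (μHE[d] : Measure Y) (g '' s) := by
  rcases isEmpty_or_nonempty Z with hZ | hZ
  · simp [Set.eq_empty_of_isEmpty]
  let k : Y → X := f ∘ Function.invFunOn g s
  have hmem : ∀ y ∈ g '' s, Function.invFunOn g s y ∈ s ∧ g (Function.invFunOn g s y) = y :=
    fun y hy => ⟨Function.invFunOn_mem hy, Function.invFunOn_eq hy⟩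
  have hk : LipschitzOnWith K k (g '' s) := by
    intro y hy z hz
    have := h _ (hmem y hy).1 _ (hmem z hz).1
    rwa [(hmem y hy).2, (hmem z hz).2] at this
  have himage : f '' s = k '' (g '' s) := by
    rw [image_image]
    refine image_congr fun z hz => ?_
    have hz' := hmem (g z) (mem_image_of_mem g hz)
    have := h _ hz _ hz'.1
    rw [hz'.2, edist_self, mul_zero, nonpos_iff_eq_zero, edist_eq_zero] at this
    exact this
  have h2 := hk.hausdorffMeasure_image_le (d := d) (Nat.cast_nonneg d)
  rw [himage, Measure.euclideanHausdorffMeasure_def, Measure.euclideanHausdorffMeasure_def,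
    Measure.smul_apply, Measure.smul_apply, Measure.nnreal_smul_coe_apply,
    Measure.nnreal_smul_coe_apply, mul_left_comm]
  gcongr
  simpa using h2

end Comparison

/-! ### Boundary charts and the tangent map in coordinates. -/

section Charts

variable {B : Type*} [TopologicalSpace B] [ChartedSpace (EuclideanHalfSpace 3) B]

theorem extChartAt_mem_range (x y : B) : extChartAt (𝓡∂ 3) x y ∈ range (𝓡∂ 3) := by
  rw [extChartAt_coe]
  exact mem_range_self _

theorem extChartAt_zero_nonneg (x y : B) : 0 ≤ extChartAt (𝓡∂ 3) x y 0 := by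
  have h := extChartAt_mem_range x y
  rwa [range_modelWithCornersEuclideanHalfSpace] at h

variable [IsManifold (𝓡∂ 3) ∞ B]

/-- Being an interior point does not depend on the chart, so a positive coordinate in any chart
would contradict `hy`. -/
theorem extChartAt_zero_of_mem_boundary {x y : B} (hy : y ∈ bodyBoundary B)
    (hyx : y ∈ (extChartAt (𝓡∂ 3) x).source) : extChartAt (𝓡∂ 3) x y 0 = 0 := by
  rw [extChartAt_source] at hyx
  by_contra h
  have h1 : extChartAt (𝓡∂ 3) x y ∈ interior (range (𝓡∂ 3)) := by
    rw [interior_range_modelWithCornersEuclideanHalfSpace]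
    exact lt_of_le_of_ne (extChartAt_zero_nonneg x y) (Ne.symm h)
  have h2 := ((𝓡∂ 3).isInteriorPoint_iff_of_mem_atlas (n := ∞) (by simp)
    (chart_mem_atlas (EuclideanHalfSpace 3) x) hyx).2
    ((chartAt _ x).mem_interior_extend_target ((chartAt _ x).map_source hyx) h1)
  exact ((𝓡∂ 3).isInteriorPoint_iff_not_isBoundaryPoint y).1 h2 hy

theorem isClosed_bodyBoundary : IsClosed (bodyBoundary B) :=
  (𝓡∂ 3).isClosed_boundary (n := ∞) (by simp)

theorem tangentCoordChange_comp_self {x y z : B} (hx : z ∈ (extChartAt (𝓡∂ 3) x).source)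
    (hy : z ∈ (extChartAt (𝓡∂ 3) y).source) :
    (tangentCoordChange (𝓡∂ 3) x y z).comp (tangentCoordChange (𝓡∂ 3) y x z) =
      ContinuousLinearMap.id ℝ ℝ³ := by
  ext1 v
  rw [ContinuousLinearMap.comp_apply, tangentCoordChange_comp ⟨⟨hy, hx⟩, hy⟩,
    tangentCoordChange_self hy]
  rfl

theorem isInvertible_tangentCoordChange {x y z : B} (hx : z ∈ (extChartAt (𝓡∂ 3) x).source)
    (hy : z ∈ (extChartAt (𝓡∂ 3) y).source) :
    (tangentCoordChange (𝓡∂ 3) x y z).IsInvertible :=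
  IsInvertible.of_inverse (tangentCoordChange_comp_self hx hy) (tangentCoordChange_comp_self hy hx)

/-- At a boundary point, the coordinate changes preserve the tangent space to the boundary and
the outward side. -/
theorem tangentCoordChange_zero {x y : B} (hy : y ∈ bodyBoundary B)
    (hyx : y ∈ (extChartAt (𝓡∂ 3) x).source) :
    ∃ c : ℝ, 0 < c ∧ ∀ v : ℝ³, tangentCoordChange (𝓡∂ 3) y x y v 0 = c * v 0 := by
  have hyy := mem_extChartAt_source (I := 𝓡∂ 3) y
  set C : ℝ³ →L[ℝ] ℝ³ := tangentCoordChange (𝓡∂ 3) y x y with hC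
  have hder : HasFDerivWithinAt (extChartAt (𝓡∂ 3) x ∘ (extChartAt (𝓡∂ 3) y).symm) C
    (range (𝓡∂ 3)) (extChartAt (𝓡∂ 3) y y) := hasFDerivWithinAt_tangentCoordChange ⟨hyy, hyx⟩
  have hu0 := extChartAt_zero_of_mem_boundary hy hyy
  set u : ℝ³ := extChartAt (𝓡∂ 3) y y with hu
  -- Follow the ray `u + t v`, `t ≥ 0`, which stays in the half-space. In the other chart its
  -- coordinate 0 vanishes at `t = 0` and is nonnegative afterwards, so its one-sided derivative is
  -- nonnegative.
  have hnonneg : ∀ v : ℝ³, 0 ≤ v 0 → 0 ≤ C v 0 := by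
    intro v hv
    have hpath : HasDerivWithinAt (fun t : ℝ => u + t • v) v (Ici 0) 0 := by
      simpa using (((hasDerivAt_id (0 : ℝ)).smul_const v).const_add u).hasDerivWithinAt
    have hmaps : MapsTo (fun t : ℝ => u + t • v) (Ici 0) (range (𝓡∂ 3)) := by
      intro t ht
      rw [range_modelWithCornersEuclideanHalfSpace]
      simp only [mem_ofPred_eq, PiLp.add_apply, PiLp.smul_apply, smul_eq_mul, hu0, zero_add]
      exact mul_nonneg ht hv
    have hcomp := HasFDerivWithinAt.comp_hasDerivWithinAt_of_eq (x := (0 : ℝ)) hder hpath hmaps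
      (by simp)
    have hproj := ((EuclideanSpace.proj (0 : Fin 3) : ℝ³ →L[ℝ] ℝ).hasFDerivAt
      (x := extChartAt (𝓡∂ 3) x ((extChartAt (𝓡∂ 3) y).symm
        (u + (0 : ℝ) • v)))).comp_hasDerivWithinAt (0 : ℝ) hcomp
    have hslope := hasDerivWithinAt_iff_tendsto_slope.1 hproj
    rw [Ici_sdiff_left] at hslope
    refine ge_of_tendsto hslope ?_
    · filter_upwards [self_mem_nhdsWithin] with t ht
      rw [slope_def_field]
      refine div_nonneg ?_ (by simpa using le_of_lt ht)
      simp only [Function.comp_apply, zero_smul, add_zero]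
      rw [hu, (extChartAt (𝓡∂ 3) y).left_inv hyy]
      change 0 ≤ extChartAt (𝓡∂ 3) x _ 0 - extChartAt (𝓡∂ 3) x y 0
      rw [extChartAt_zero_of_mem_boundary hy hyx, sub_zero]
      exact extChartAt_zero_nonneg _ _
  have htan : ∀ v : ℝ³, v 0 = 0 → C v 0 = 0 := by
    intro v hv
    have h1 := hnonneg v hv.ge
    have h2 := hnonneg (-v) (by simp [hv])
    simp only [map_neg, PiLp.neg_apply] at h2
    linarith
  have hlin : ∀ v : ℝ³, C v 0 = C (EuclideanSpace.single 0 1) 0 * v 0 := by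
    intro v
    have h := htan (v - v 0 • EuclideanSpace.single 0 1) (by simp)
    simp only [map_sub, map_smul, PiLp.sub_apply, PiLp.smul_apply, smul_eq_mul] at h
    linarith
  refine ⟨C (EuclideanSpace.single 0 1) 0, ?_, hlin⟩
  -- If the constant were zero, `C` would map into the hyperplane and not be surjective.
  refine lt_of_le_of_ne (hnonneg _ (by simp)) fun h => ?_
  obtain ⟨v, hv⟩ := (isInvertible_tangentCoordChange hyy hyx).bijective.2
    (EuclideanSpace.single 0 1)
  have h1 := hlin v
  rw [← h, zero_mul, hC, hv] at h1
  simp at h1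

variable {E : Type*} [NormedAddCommGroup E] [InnerProductSpace ℝ E]

/-- The tangent map of `p` at `y`, expressed in the chart at `x`. -/
def chartDeriv (p : B → E) (x y : B) : ℝ³ →L[ℝ] E :=
  fderivWithin ℝ (p ∘ (extChartAt (𝓡∂ 3) x).symm) (range (𝓡∂ 3)) (extChartAt (𝓡∂ 3) x y)

variable {p : B → E}

theorem contDiffWithinAt_comp_extChartAt_symm (hp : ContMDiff (𝓡∂ 3) 𝓘(ℝ, E) ∞ p) (x : B)
    {u : ℝ³} (hu : u ∈ (extChartAt (𝓡∂ 3) x).target) :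
    ContDiffWithinAt ℝ ∞ (p ∘ (extChartAt (𝓡∂ 3) x).symm) (range (𝓡∂ 3)) u := by
  have h := hp.comp_contMDiffOn (contMDiffOn_extChartAt_symm (I := 𝓡∂ 3) (n := ∞) x)
  have h2 := contMDiffWithinAt_iff_contDiffWithinAt.1 (h u hu)
  exact h2.mono_of_mem_nhdsWithin (extChartAt_target_mem_nhdsWithin_of_mem hu)

theorem hasFDerivWithinAt_chartDeriv (hp : ContMDiff (𝓡∂ 3) 𝓘(ℝ, E) ∞ p) {x y : B}
    (hy : y ∈ (extChartAt (𝓡∂ 3) x).source) :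
    HasFDerivWithinAt (p ∘ (extChartAt (𝓡∂ 3) x).symm) (chartDeriv p x y) (range (𝓡∂ 3))
      (extChartAt (𝓡∂ 3) x y) :=
  ((contDiffWithinAt_comp_extChartAt_symm hp x
    ((extChartAt (𝓡∂ 3) x).map_source hy)).differentiableWithinAt (by simp)).hasFDerivWithinAt

/-- Chain rule through the chart change; derivatives within the half-space are unique even at its
boundary. -/
theorem tangentF_eq_chartDeriv_comp (hp : ContMDiff (𝓡∂ 3) 𝓘(ℝ, E) ∞ p) {x y : B}
    (hy : y ∈ (extChartAt (𝓡∂ 3) x).source) :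
    tangentF p y = (chartDeriv p x y).comp (tangentCoordChange (𝓡∂ 3) y x y) := by
  have hyy := mem_extChartAt_source (I := 𝓡∂ 3) y
  have hu : (extChartAt (𝓡∂ 3) y).symm (extChartAt (𝓡∂ 3) y y) = y := extChartAt_to_inv y
  have h1 : HasFDerivWithinAt (p ∘ (extChartAt (𝓡∂ 3) y).symm) (tangentF p y)
      (range (𝓡∂ 3)) (extChartAt (𝓡∂ 3) y y) := by
    have := ((hp.mdifferentiableAt (by simp)).hasMFDerivAt (x := y)).2
    exact this
  have h2 : HasFDerivWithinAt (p ∘ (extChartAt (𝓡∂ 3) x).symm) (chartDeriv p x y)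
      (range (𝓡∂ 3))
      ((extChartAt (𝓡∂ 3) x ∘ (extChartAt (𝓡∂ 3) y).symm) (extChartAt (𝓡∂ 3) y y)) := by
    rw [Function.comp_apply, hu]
    exact hasFDerivWithinAt_chartDeriv hp hy
  have h3 := h2.comp _ (hasFDerivWithinAt_tangentCoordChange (I := 𝓡∂ 3) ⟨hyy, hy⟩)
    fun v _ => extChartAt_mem_range x _
  refine ((𝓡∂ 3).uniqueDiffOn _ (extChartAt_mem_range y y)).eq h1 (h3.congr_of_eventuallyEq ?_ ?_)
  · have hc : ContinuousWithinAt (extChartAt (𝓡∂ 3) y).symm (range (𝓡∂ 3))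
      (extChartAt (𝓡∂ 3) y y) := (continuousAt_extChartAt_symm y).continuousWithinAt
    have hs : (extChartAt (𝓡∂ 3) x).source ∈ 𝓝 ((extChartAt (𝓡∂ 3) y).symm
        (extChartAt (𝓡∂ 3) y y)) := by
      rw [hu]
      exact extChartAt_source_mem_nhds' hy
    filter_upwards [hc hs] with v hv
    simp only [Function.comp_apply]
    rw [(extChartAt (𝓡∂ 3) x).left_inv hv]
  · simp only [Function.comp_apply]
    rw [hu, (extChartAt (𝓡∂ 3) x).left_inv hy]

theorem chartDeriv_self (hp : ContMDiff (𝓡∂ 3) 𝓘(ℝ, E) ∞ p) (x : B) :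
    chartDeriv p x x = tangentF p x := by
  have h := tangentF_eq_chartDeriv_comp hp (mem_extChartAt_source (I := 𝓡∂ 3) x)
  refine ContinuousLinearMap.ext fun v => ?_
  rw [h]
  change _ = chartDeriv p x x (tangentCoordChange (𝓡∂ 3) x x x v)
  rw [tangentCoordChange_self (mem_extChartAt_source x)]

theorem isInvertible_chartDeriv [Fact (Module.finrank ℝ E = 3)]
    (hp : ContMDiff (𝓡∂ 3) 𝓘(ℝ, E) ∞ p) {x y : B} (hy : y ∈ (extChartAt (𝓡∂ 3) x).source)
    (hF : Function.Injective (tangentF p y)) : (chartDeriv p x y).IsInvertible := by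
  have : FiniteDimensional ℝ E := .of_fact_finrank_eq_succ 2
  have : CompleteSpace E := FiniteDimensional.complete ℝ E
  have hC := (isInvertible_tangentCoordChange (mem_extChartAt_source (I := 𝓡∂ 3) y) hy).bijective
  have hinj : Function.Injective (chartDeriv p x y) := by
    intro v w hvw
    obtain ⟨v, rfl⟩ := hC.2 v
    obtain ⟨w, rfl⟩ := hC.2 w
    rw [tangentF_eq_chartDeriv_comp hp hy] at hF
    exact congrArg _ (hF hvw)
  refine isInvertible_of_bijective ⟨hinj, ?_⟩
  exact (LinearMap.injective_iff_surjective_of_finrank_eq_finrank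
    (f := (chartDeriv p x y).toLinearMap)
    ((finrank_euclideanSpace_fin (𝕜 := ℝ)).trans (Fact.out : Module.finrank ℝ E = 3).symm)).1 hinj

/-- The chart at `x` stays fixed while the point moves. The diagonal `y ↦ chartDeriv p y y` changes
charts and need not be continuous. -/
theorem continuousOn_chartDeriv (hp : ContMDiff (𝓡∂ 3) 𝓘(ℝ, E) ∞ p) (x : B) :
    ContinuousOn (chartDeriv p x) (extChartAt (𝓡∂ 3) x).source := by
  have h : ContinuousOn (fderivWithin ℝ (p ∘ (extChartAt (𝓡∂ 3) x).symm) (range (𝓡∂ 3)))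
      (extChartAt (𝓡∂ 3) x).target := fun u hu =>
    (((contDiffWithinAt_comp_extChartAt_symm hp x hu).fderivWithin_right (m := 0)
      (𝓡∂ 3).uniqueDiffOn (by simp)
      (extChartAt_target_subset_range x hu)).continuousWithinAt).mono
      (extChartAt_target_subset_range x)
  exact h.comp (continuousOn_extChartAt x) (extChartAt (𝓡∂ 3) x).mapsTo

/-- Near `x`, the map `p` differs little from its linearization in the chart at `x`. -/
theorem exists_mem_nhds_norm_sub_le (hp : ContMDiff (𝓡∂ 3) 𝓘(ℝ, E) ∞ p) (x : B) {ε : ℝ}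
    (hε : 0 < ε) : ∃ U ∈ 𝓝 x, U ⊆ (extChartAt (𝓡∂ 3) x).source ∧ ∀ y ∈ U, ∀ z ∈ U,
      ‖p y - p z - chartDeriv p x x (extChartAt (𝓡∂ 3) x y - extChartAt (𝓡∂ 3) x z)‖ ≤
        ε * ‖extChartAt (𝓡∂ 3) x y - extChartAt (𝓡∂ 3) x z‖ := by
  set ψ := extChartAt (𝓡∂ 3) x with hψ
  set f := p ∘ ψ.symm with hf
  set D := fderivWithin ℝ f (range (𝓡∂ 3)) with hD
  have hxt : ψ x ∈ ψ.target := mem_extChartAt_target x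
  have hDc : ContinuousWithinAt D (range (𝓡∂ 3)) (ψ x) :=
    ((contDiffWithinAt_comp_extChartAt_symm hp x hxt).fderivWithin_right (m := 0)
      (𝓡∂ 3).uniqueDiffOn (by simp) (extChartAt_mem_range x x)).continuousWithinAt
  have hev : ∀ᶠ u in 𝓝[range (𝓡∂ 3)] (ψ x), u ∈ ψ.target ∧ ‖D u - D (ψ x)‖ ≤ ε := by
    filter_upwards [extChartAt_target_mem_nhdsWithin x, hDc (Metric.closedBall_mem_nhds _ hε)]
      with u hu hu'
    exact ⟨hu, by simpa [dist_eq_norm] using hu'⟩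
  obtain ⟨r, hr, hball⟩ := Metric.mem_nhdsWithin_iff.1 hev
  -- The half-ball is convex, so the mean value inequality applies up to the boundary.
  have hconv : Convex ℝ (Metric.ball (ψ x) r ∩ range (𝓡∂ 3)) :=
    (convex_ball _ _).inter (𝓡∂ 3).convex_range
  refine ⟨ψ.source ∩ ψ ⁻¹' Metric.ball (ψ x) r, inter_mem (extChartAt_source_mem_nhds x)
    ((continuousAt_extChartAt x) (Metric.ball_mem_nhds _ hr)), inter_subset_left, ?_⟩
  intro y hy z hz
  have hd : ∀ u ∈ Metric.ball (ψ x) r ∩ range (𝓡∂ 3), HasFDerivWithinAt f (D u)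
      (Metric.ball (ψ x) r ∩ range (𝓡∂ 3)) u := fun u hu =>
    ((contDiffWithinAt_comp_extChartAt_symm hp x (hball hu).1).differentiableWithinAt
      (by simp)).hasFDerivWithinAt.mono inter_subset_right
  have := hconv.norm_image_sub_le_of_norm_hasFDerivWithin_le' hd (fun u hu => (hball hu).2)
    ⟨hz.2, extChartAt_mem_range x z⟩ ⟨hy.2, extChartAt_mem_range x y⟩
  rw [hf, Function.comp_apply, Function.comp_apply, ψ.left_inv hy.1, ψ.left_inv hz.1] at this
  exact this

end Charts

/-! ### Continuous dependence of normals and area factors on the linear map. -/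

section Continuity

variable {E : Type*} [NormedAddCommGroup E] [InnerProductSpace ℝ E] [CompleteSpace E]

theorem continuousAt_conormal {A : ℝ³ →L[ℝ] E} (hA : A.IsInvertible) :
    ContinuousAt (conormal (E := E)) A := by
  have h : ContinuousAt (fun A : ℝ³ →L[ℝ] E => A.inverse) A :=
    (hA.contDiffAt_map_inverse (n := 0)).continuousAt
  refine (InnerProductSpace.toDual ℝ E).symm.continuous.continuousAt.comp ?_
  exact (continuousAt_const.clm_comp h).neg

theorem continuousAt_outerUnitNormal {A : ℝ³ →L[ℝ] E} (hA : A.IsInvertible) :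
    ContinuousAt (fun A : ℝ³ →L[ℝ] E => ‖conormal A‖⁻¹ • conormal A) A :=
  ((continuousAt_conormal hA).norm.inv₀ (norm_ne_zero_iff.2 (conormal_ne_zero hA))).smul
    (continuousAt_conormal hA)

theorem continuousAt_areaFactor [Fact (Module.finrank ℝ E = 3)] (o : Orientation ℝ E (Fin 3))
    {A : ℝ³ →L[ℝ] E} (hA : A.IsInvertible) : ContinuousAt (areaFactor (E := E) o) A := by
  have : FiniteDimensional ℝ E := .of_fact_finrank_eq_succ 2
  let b := (stdOrthonormalBasis ℝ E).reindex (finCongr (Fact.out : Module.finrank ℝ E = 3))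
  have h : Continuous fun A : ℝ³ →L[ℝ] E =>
      |o.volumeForm fun i => A (EuclideanSpace.single i 1)| := by
    simp_rw [o.volumeForm_robust' b, Module.Basis.det_apply]
    refine (Continuous.matrix_det (continuous_matrix fun i j => ?_)).abs
    simp only [Module.Basis.toMatrix_apply, OrthonormalBasis.coe_toBasis_repr_apply,
      OrthonormalBasis.repr_apply_apply]
    fun_prop
  exact h.continuousAt.mul (continuousAt_conormal hA).norm

end Continuity

/-! ### From local, approximate inequalities to equality of measures. -/

section LocalComparison

/-- The inequality on subsets of an open set passes to a union of two such sets by cutting along one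
of them; compactness then reduces to finitely many. -/
theorem MeasureTheory.Measure.le_of_forall_nhds {X : Type*} [TopologicalSpace X] [CompactSpace X]
    [MeasurableSpace X] [OpensMeasurableSpace X] {μ ν : Measure X}
    (h : ∀ x, ∃ U ∈ 𝓝 x, ∀ s ⊆ U, MeasurableSet s → μ s ≤ ν s) : μ ≤ ν := by
  have key : ∃ O : Set X, IsOpen O ∧ univ ⊆ O ∧ ∀ s ⊆ O, MeasurableSet s → μ s ≤ ν s := by
    refine isCompact_univ.induction_on
      (p := fun t => ∃ O : Set X, IsOpen O ∧ t ⊆ O ∧ ∀ s ⊆ O, MeasurableSet s → μ s ≤ ν s)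
      ⟨∅, isOpen_empty, subset_rfl, fun s hs _ => by simp [subset_empty_iff.1 hs]⟩ ?_ ?_ ?_
    · rintro s t hst ⟨O, hO, htO, h'⟩
      exact ⟨O, hO, hst.trans htO, h'⟩
    · rintro s t ⟨O, hO, hs, h1⟩ ⟨O', hO', ht, h2⟩
      refine ⟨O ∪ O', hO.union hO', union_subset_union hs ht, fun A hA hm => ?_⟩
      rw [← measure_inter_add_sdiff A hO.measurableSet (μ := μ),
        ← measure_inter_add_sdiff A hO.measurableSet (μ := ν)]
      exact add_le_add (h1 _ inter_subset_right (hm.inter hO.measurableSet))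
        (h2 _ (sdiff_subset_iff.2 hA) (hm.diff hO.measurableSet))
    · intro x _
      obtain ⟨U, hU, h'⟩ := h x
      refine ⟨interior U, mem_nhdsWithin_of_mem_nhds (interior_mem_nhds.2 hU), interior U,
        isOpen_interior, subset_rfl, fun s hs hm => h' s (hs.trans interior_subset) hm⟩
  obtain ⟨O, -, hO, h'⟩ := key
  exact Measure.le_iff.2 fun s hs => h' s ((subset_univ s).trans hO) hs

theorem MeasureTheory.Measure.le_of_forall_one_lt_smul {X : Type*} [MeasurableSpace X]
    {μ ν : Measure X} (n : ℕ)
    (h : ∀ r : NNReal, 1 < r → μ ≤ ((r : ENNReal) ^ n) • ν) : μ ≤ ν := by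
  refine Measure.le_iff.2 fun s _ => ?_
  have ht : Tendsto (fun r : NNReal => (r : ENNReal) ^ n * ν s) (𝓝[>] 1)
      (𝓝 (((1 : NNReal) : ENNReal) ^ n * ν s)) := by
    refine ENNReal.Tendsto.mul_const ?_ (Or.inl (by simp))
    exact ((ENNReal.continuous_pow n).comp ENNReal.continuous_coe).continuousAt.mono_left
      nhdsWithin_le_nhds
  rw [ENNReal.coe_one, one_pow, one_mul] at ht
  refine ge_of_tendsto ht ?_
  filter_upwards [self_mem_nhdsWithin] with r hr
  exact h r hr s

theorem norm_le_mul_of_norm_sub_le {E : Type*} [NormedAddCommGroup E] {a b : E} {δ : ℝ}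
    (hδ : 0 ≤ δ) (hδ' : δ ≤ 1 / 2) (h : ‖a - b‖ ≤ δ * ‖b‖) :
    ‖a‖ ≤ (1 + 2 * δ) * ‖b‖ ∧ ‖b‖ ≤ (1 + 2 * δ) * ‖a‖ := by
  have h1 : ‖a‖ ≤ ‖b‖ + ‖a - b‖ := by simpa using norm_add_le b (a - b)
  have h2 : ‖b‖ ≤ ‖a‖ + ‖a - b‖ := by
    rw [norm_sub_rev]; simpa using norm_add_le a (b - a)
  have ha := norm_nonneg a
  have hb := norm_nonneg b
  refine ⟨by nlinarith, ?_⟩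
  have h3 : (1 - δ) * ‖b‖ ≤ ‖a‖ := by linarith
  have h4 : (1 + 2 * δ) * ((1 - δ) * ‖b‖) ≤ (1 + 2 * δ) * ‖a‖ := by gcongr
  -- The difference of the two sides is `δ (1 - 2 δ)`, whence the bound `δ ≤ 1 / 2`.
  have h5 : 1 ≤ (1 + 2 * δ) * (1 - δ) := by nlinarith
  nlinarith

variable {B : Type*} [TopologicalSpace B] [ChartedSpace (EuclideanHalfSpace 3) B]
  [IsManifold (𝓡∂ 3) ∞ B]
  {E : Type*} [NormedAddCommGroup E] [InnerProductSpace ℝ E] {p : B → E}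

theorem exists_mem_nhds_edist_le (hp : ContMDiff (𝓡∂ 3) 𝓘(ℝ, E) ∞ p) {x : B}
    (hF : (chartDeriv p x x).IsInvertible) {r : NNReal} (hr : 1 < r) :
    ∃ U ∈ 𝓝 x, U ⊆ (extChartAt (𝓡∂ 3) x).source ∧ ∀ y ∈ U, ∀ z ∈ U,
      edist (p y) (p z) ≤ r * edist (chartDeriv p x x (extChartAt (𝓡∂ 3) x y))
        (chartDeriv p x x (extChartAt (𝓡∂ 3) x z)) ∧
      edist (chartDeriv p x x (extChartAt (𝓡∂ 3) x y))
        (chartDeriv p x x (extChartAt (𝓡∂ 3) x z)) ≤ r * edist (p y) (p z) := by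
  set F := chartDeriv p x x with hFdef
  have hr' : (1 : ℝ) < r := by exact_mod_cast hr
  obtain ⟨δ, hδ, hδ2, hδr⟩ : ∃ δ : ℝ, 0 < δ ∧ δ ≤ 1 / 2 ∧ 1 + 2 * δ ≤ r := by
    refine ⟨min (1 / 2) ((r - 1) / 2), by positivity [sub_pos.2 hr'], min_le_left _ _, ?_⟩
    have := min_le_right (1 / 2 : ℝ) ((r - 1) / 2)
    linarith
  have hK : 0 < ‖F.inverse‖ + 1 := by positivity
  -- The bound `‖w‖ ≤ (‖F⁻¹‖ + 1) ‖F w‖` will turn this error, relative to `‖w‖`, into `δ` relative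
  -- to `‖F w‖`; the `+ 1` keeps the denominator positive.
  obtain ⟨U, hU, hUs, h⟩ := exists_mem_nhds_norm_sub_le hp x (div_pos hδ hK)
  refine ⟨U, hU, hUs, fun y hy z hz => ?_⟩
  have h1 := h y hy z hz
  set w : ℝ³ := extChartAt (𝓡∂ 3) x y - extChartAt (𝓡∂ 3) x z with hw
  have h2 : ‖w‖ ≤ (‖F.inverse‖ + 1) * ‖F w‖ := by
    calc ‖w‖ = ‖F.inverse (F w)‖ := by rw [hF.inverse_apply_self]
      _ ≤ ‖F.inverse‖ * ‖F w‖ := F.inverse.le_opNorm _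
      _ ≤ _ := by gcongr; linarith
  have h3 : ‖p y - p z - F w‖ ≤ δ * ‖F w‖ := by
    refine h1.trans ?_
    calc δ / (‖F.inverse‖ + 1) * ‖w‖
        ≤ δ / (‖F.inverse‖ + 1) * ((‖F.inverse‖ + 1) * ‖F w‖) := by gcongr
      _ = δ * ‖F w‖ := by field_simp
  obtain ⟨h4, h5⟩ := norm_le_mul_of_norm_sub_le hδ.le hδ2 h3
  have hconv : ∀ {a b c d : E}, ‖a - b‖ ≤ (1 + 2 * δ) * ‖c - d‖ → edist a b ≤ r * edist c d := by
    intro a b c d h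
    rw [edist_nndist, edist_nndist, ← ENNReal.coe_mul, ENNReal.coe_le_coe, ← NNReal.coe_le_coe,
      NNReal.coe_mul, coe_nndist, coe_nndist, dist_eq_norm, dist_eq_norm]
    exact h.trans (by gcongr)
  rw [hw, map_sub] at h4 h5
  exact ⟨hconv h4, hconv h5⟩

variable [CompleteSpace E] [MeasurableSpace E] [BorelSpace E]

/-- Near a boundary point, the area of the image of a piece of the boundary is almost the area of
its image under the linearization. -/
theorem exists_mem_nhds_area [Fact (Module.finrank ℝ E = 3)] (o : Orientation ℝ E (Fin 3))
    (hp : ContMDiff (𝓡∂ 3) 𝓘(ℝ, E) ∞ p) {x : B} (hF : (chartDeriv p x x).IsInvertible)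
    {r : NNReal} (hr : 1 < r) :
    ∃ U ∈ 𝓝 x, ∀ s ⊆ U ∩ bodyBoundary B,
      volume (planeInclusion ⁻¹' (extChartAt (𝓡∂ 3) x '' s)) < ⊤ ∧
      (μHE[2] : Measure E) (p '' s) ≤ r ^ 2 * (ENNReal.ofReal (areaFactor o (chartDeriv p x x)) *
        volume (planeInclusion ⁻¹' (extChartAt (𝓡∂ 3) x '' s))) ∧
      ENNReal.ofReal (areaFactor o (chartDeriv p x x)) *
        volume (planeInclusion ⁻¹' (extChartAt (𝓡∂ 3) x '' s)) ≤
          r ^ 2 * (μHE[2] : Measure E) (p '' s) := by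
  obtain ⟨U, hU, hUs, h⟩ := exists_mem_nhds_edist_le hp hF hr
  -- The ball only serves to bound the coordinate image, so that its area is finite; any radius
  -- would do.
  refine ⟨U ∩ extChartAt (𝓡∂ 3) x ⁻¹' Metric.ball (extChartAt (𝓡∂ 3) x x) 1,
    inter_mem hU ((continuousAt_extChartAt x) (Metric.ball_mem_nhds _ one_pos)), fun s hs => ?_⟩
  have hsU : s ⊆ U := fun y hy => (hs hy).1.1
  have himg : (μHE[2] : Measure E)
      ((fun y => chartDeriv p x x (extChartAt (𝓡∂ 3) x y)) '' s) =
      ENNReal.ofReal (areaFactor o (chartDeriv p x x)) *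
        volume (planeInclusion ⁻¹' (extChartAt (𝓡∂ 3) x '' s)) := by
    rw [← euclideanHausdorffMeasure_image_hyperplane o hF, image_image]
    rintro _ ⟨y, hy, rfl⟩
    exact extChartAt_zero_of_mem_boundary (hs hy).2 (hUs (hsU hy))
  refine ⟨?_, ?_, ?_⟩
  · refine (Metric.isBounded_closedBall (x := (0 : ℝ²))
      (r := ‖extChartAt (𝓡∂ 3) x x‖ + 1)).subset ?_ |>.measure_lt_top
    rintro v ⟨y, hy, hyv⟩
    have h1 := (hs hy).1.2
    rw [mem_preimage, mem_ball_iff_norm] at h1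
    rw [mem_closedBall_zero_iff, ← norm_planeInclusion, ← hyv]
    have := norm_le_norm_add_norm_sub' (extChartAt (𝓡∂ 3) x y) (extChartAt (𝓡∂ 3) x x)
    linarith
  · rw [← himg]
    exact euclideanHausdorffMeasure_image_le_of_edist_le 2
      fun y hy z hz => (h y (hsU hy) z (hsU hz)).1
  · rw [← himg]
    exact euclideanHausdorffMeasure_image_le_of_edist_le 2
      fun y hy z hz => (h y (hsU hy) z (hsU hz)).2

end LocalComparison

/-! ### The tangent map in the preferred chart of each point. -/

section ChartAtPoint

variable {B : Type*} [TopologicalSpace B] [ChartedSpace (EuclideanHalfSpace 3) B]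
  [IsManifold (𝓡∂ 3) ∞ B]
  {E : Type*} [NormedAddCommGroup E] [InnerProductSpace ℝ E] {p : B → E}

theorem chartDeriv_self_eq_comp (hp : ContMDiff (𝓡∂ 3) 𝓘(ℝ, E) ∞ p) {x y : B}
    (hy : y ∈ (extChartAt (𝓡∂ 3) x).source) :
    chartDeriv p y y = (chartDeriv p x y).comp (tangentCoordChange (𝓡∂ 3) y x y) := by
  rw [← tangentF_eq_chartDeriv_comp hp hy]
  exact chartDeriv_self hp y

theorem continuousAt_chartDeriv (hp : ContMDiff (𝓡∂ 3) 𝓘(ℝ, E) ∞ p) (x : B) :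
    ContinuousAt (chartDeriv p x) x :=
  (continuousOn_chartDeriv hp x).continuousAt (extChartAt_source_mem_nhds x)

theorem isInvertible_chartDeriv_self [Fact (Module.finrank ℝ E = 3)]
    (hp : ContMDiff (𝓡∂ 3) 𝓘(ℝ, E) ∞ p)
    (hp' : ∀ x, Function.Injective (tangentF p x)) (x : B) : (chartDeriv p x x).IsInvertible :=
  isInvertible_chartDeriv hp (mem_extChartAt_source x) (hp' x)

end ChartAtPoint

/-! ### The pulled-back area measure is carried by the boundary. -/

section BodyArea

variable {B : Type*} [TopologicalSpace B] [ChartedSpace (EuclideanHalfSpace 3) B]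
  [IsManifold (𝓡∂ 3) ∞ B] [MeasurableSpace B] [BorelSpace B]
  {E : Type*} [NormedAddCommGroup E] [MeasurableSpace E] [BorelSpace E] {p : B → E}

theorem bodyArea_apply (hp : MeasurableEmbedding p) (s : Set B) :
    bodyArea p s = (μHE[2] : Measure E) (p '' (s ∩ bodyBoundary B)) := by
  rw [bodyArea, hp.comap_apply, spaceArea,
    Measure.restrict_apply' (hp.measurableSet_image.2 isClosed_bodyBoundary.measurableSet),
    ← image_inter hp.injective]

theorem bodyArea_restrict (hp : MeasurableEmbedding p) :
    (bodyArea p).restrict (bodyBoundary B) = bodyArea p := by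
  ext s hs
  rw [Measure.restrict_apply hs, bodyArea_apply hp, bodyArea_apply hp, inter_assoc, inter_self]

end BodyArea

/-! ### The area density and the change of variables on the boundary. -/

section AreaDensity

variable {B : Type*} [TopologicalSpace B] [ChartedSpace (EuclideanHalfSpace 3) B]
  [IsManifold (𝓡∂ 3) ∞ B]
  {E : Type*} [NormedAddCommGroup E] [InnerProductSpace ℝ E] [CompleteSpace E]
  [Fact (Module.finrank ℝ E = 3)] (o : Orientation ℝ E (Fin 3)) {p p₀ : B → E}

/-- The density of the area measure pulled back by `p` with respect to the one pulled back
by `p₀`. -/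
def areaDensity (p p₀ : B → E) (x : B) : ℝ :=
  areaFactor o (chartDeriv p x x) / areaFactor o (chartDeriv p₀ x x)

theorem areaDensity_pos (hp : ContMDiff (𝓡∂ 3) 𝓘(ℝ, E) ∞ p)
    (hp' : ∀ x, Function.Injective (tangentF p x)) (hp₀ : ContMDiff (𝓡∂ 3) 𝓘(ℝ, E) ∞ p₀)
    (hp₀' : ∀ x, Function.Injective (tangentF p₀ x)) (x : B) : 0 < areaDensity o p p₀ x :=
  div_pos (areaFactor_pos o (isInvertible_chartDeriv_self hp hp' x))
    (areaFactor_pos o (isInvertible_chartDeriv_self hp₀ hp₀' x))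

theorem areaDensity_eq (hp : ContMDiff (𝓡∂ 3) 𝓘(ℝ, E) ∞ p)
    (hp' : ∀ x, Function.Injective (tangentF p x)) (hp₀ : ContMDiff (𝓡∂ 3) 𝓘(ℝ, E) ∞ p₀)
    (hp₀' : ∀ x, Function.Injective (tangentF p₀ x)) {x y : B} (hyB : y ∈ bodyBoundary B)
    (hy : y ∈ (extChartAt (𝓡∂ 3) x).source) :
    areaDensity o p p₀ y =
      areaFactor o (chartDeriv p x y) / areaFactor o (chartDeriv p₀ x y) := by
  obtain ⟨c, hc, h0⟩ := tangentCoordChange_zero hyB hy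
  rw [areaDensity, chartDeriv_self_eq_comp hp hy, chartDeriv_self_eq_comp hp₀ hy]
  exact areaFactor_div_comp o (isInvertible_chartDeriv hp hy (hp' y))
    (isInvertible_chartDeriv hp₀ hy (hp₀' y))
    (isInvertible_tangentCoordChange (mem_extChartAt_source y) hy) hc h0

/-- Near `x`, `areaDensity_eq` rewrites the density in the fixed chart at `x`, where everything is
continuous. This needs boundary points: only there do coordinate changes preserve the hyperplane. -/
theorem continuousOn_areaDensity (hp : ContMDiff (𝓡∂ 3) 𝓘(ℝ, E) ∞ p)
    (hp' : ∀ x, Function.Injective (tangentF p x)) (hp₀ : ContMDiff (𝓡∂ 3) 𝓘(ℝ, E) ∞ p₀)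
    (hp₀' : ∀ x, Function.Injective (tangentF p₀ x)) :
    ContinuousOn (areaDensity o p p₀) (bodyBoundary B) := by
  intro x hx
  have hF := isInvertible_chartDeriv_self hp hp' x
  have hF₀ := isInvertible_chartDeriv_self hp₀ hp₀' x
  have h : ContinuousAt
      (fun y => areaFactor o (chartDeriv p x y) / areaFactor o (chartDeriv p₀ x y)) x :=
    ((continuousAt_areaFactor o hF).comp (continuousAt_chartDeriv hp x)).div
      ((continuousAt_areaFactor o hF₀).comp (continuousAt_chartDeriv hp₀ x))
      (areaFactor_pos o hF₀).ne'
  refine h.continuousWithinAt.congr_of_eventuallyEq ?_ rfl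
  filter_upwards [self_mem_nhdsWithin,
    mem_nhdsWithin_of_mem_nhds (extChartAt_source_mem_nhds (I := 𝓡∂ 3) x)] with y hyB hy
  exact areaDensity_eq o hp hp' hp₀ hp₀' hyB hy

theorem continuousOn_outerUnitNormal (hp : ContMDiff (𝓡∂ 3) 𝓘(ℝ, E) ∞ p)
    (hp' : ∀ x, Function.Injective (tangentF p x)) :
    ContinuousOn (fun x => outerUnitNormal (euclideanMetric E) (chartDeriv p x x))
      (bodyBoundary B) := by
  intro x hx
  have hF := isInvertible_chartDeriv_self hp hp' x
  have h := ContinuousAt.comp (f := chartDeriv p x) (continuousAt_outerUnitNormal hF)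
    (continuousAt_chartDeriv hp x)
  refine h.continuousWithinAt.congr_of_eventuallyEq ?_ (outerUnitNormal_eq hF)
  filter_upwards [self_mem_nhdsWithin,
    mem_nhdsWithin_of_mem_nhds (extChartAt_source_mem_nhds (I := 𝓡∂ 3) x)] with y hyB hy
  obtain ⟨c, hc, h0⟩ := tangentCoordChange_zero hyB hy
  rw [chartDeriv_self_eq_comp hp hy, outerUnitNormal_comp (isInvertible_chartDeriv hp hy (hp' y))
    (isInvertible_tangentCoordChange (mem_extChartAt_source y) hy) hc h0,
    outerUnitNormal_eq (isInvertible_chartDeriv hp hy (hp' y))]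
  rfl

variable [MeasurableSpace B] [BorelSpace B] [MeasurableSpace E] [BorelSpace E]

variable [CompactSpace B]

theorem isFiniteMeasure_bodyArea (hpm : MeasurableEmbedding p)
    (hp : ContMDiff (𝓡∂ 3) 𝓘(ℝ, E) ∞ p) (hp' : ∀ x, Function.Injective (tangentF p x)) :
    IsFiniteMeasure (bodyArea p) := by
  have : FiniteDimensional ℝ E := .of_fact_finrank_eq_succ 2
  -- Any orientation will do; the area factor involves only the absolute value of the volume form.
  have o : Orientation ℝ E (Fin 3) :=
    ((stdOrthonormalBasis ℝ E).reindex (finCongr Fact.out)).toBasis.orientation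
  refine ⟨isCompact_univ.measure_lt_top_of_nhdsWithin fun x _ => ?_⟩
  rw [nhdsWithin_univ]
  by_cases hx : x ∈ bodyBoundary B
  · obtain ⟨U, hU, h⟩ := exists_mem_nhds_area o hp (isInvertible_chartDeriv_self hp hp' x)
      (r := 2) (by norm_num)
    obtain ⟨h1, h2, -⟩ := h _ subset_rfl
    refine ⟨U, hU, ?_⟩
    rw [bodyArea_apply hpm]
    refine h2.trans_lt ?_
    exact ENNReal.mul_lt_top (by simp) (ENNReal.mul_lt_top ENNReal.ofReal_lt_top h1)
  · refine ⟨(bodyBoundary B)ᶜ, isClosed_bodyBoundary.isOpen_compl.mem_nhds hx, ?_⟩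
    rw [bodyArea_apply hpm]
    simp

/-- Change of variables between the areas of the boundary in two configurations. -/
theorem bodyArea_eq_withDensity (hpm : MeasurableEmbedding p) (hp : ContMDiff (𝓡∂ 3) 𝓘(ℝ, E) ∞ p)
    (hp' : ∀ x, Function.Injective (tangentF p x)) (hpm₀ : MeasurableEmbedding p₀)
    (hp₀ : ContMDiff (𝓡∂ 3) 𝓘(ℝ, E) ∞ p₀) (hp₀' : ∀ x, Function.Injective (tangentF p₀ x)) :
    bodyArea p =
      (bodyArea p₀).withDensity fun x => ENNReal.ofReal (areaDensity o p p₀ x) := by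
  set ν := bodyArea p
  set ν₀ := bodyArea p₀
  set J := areaDensity o p p₀ with hJ
  have hJpos : ∀ x, 0 < J x := areaDensity_pos o hp hp' hp₀ hp₀'
  have hdens : ∀ s, MeasurableSet s → ν₀.withDensity (fun x => ENNReal.ofReal (J x)) s =
      ∫⁻ x in s ∩ bodyBoundary B, ENNReal.ofReal (J x) ∂ν₀ := by
    intro s hs
    have hres : ν₀.restrict (bodyBoundary B) = ν₀ := bodyArea_restrict hpm₀
    rw [withDensity_apply _ hs, ← Measure.restrict_restrict hs, hres]
  -- The exponent 5 collects `r ^ 2` from linearizing `p`, `r ^ 2` from linearizing `p₀`, and one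
  -- `r` from freezing `J` at `x`.
  have key : ∀ r : NNReal, 1 < r → ∀ x : B, ∃ U ∈ 𝓝 x, ∀ s ⊆ U, MeasurableSet s →
      ν s ≤ (r : ENNReal) ^ 5 * ν₀.withDensity (fun x => ENNReal.ofReal (J x)) s ∧
      ν₀.withDensity (fun x => ENNReal.ofReal (J x)) s ≤ (r : ENNReal) ^ 5 * ν s := by
    intro r hr x
    by_cases hx : x ∈ bodyBoundary B
    swap
    -- Away from the boundary both measures vanish.
    · refine ⟨(bodyBoundary B)ᶜ, isClosed_bodyBoundary.isOpen_compl.mem_nhds hx,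
        fun s hs hm => ?_⟩
      rw [hdens s hm, bodyArea_apply hpm, (disjoint_compl_left.mono_left hs).inter_eq]
      simp
    have hF := isInvertible_chartDeriv_self hp hp' x
    have hF₀ := isInvertible_chartDeriv_self hp₀ hp₀' x
    obtain ⟨U, hU, h⟩ := exists_mem_nhds_area o hp hF hr
    obtain ⟨U₀, hU₀, h₀⟩ := exists_mem_nhds_area o hp₀ hF₀ hr
    have hr' : (1 : ℝ) < r := by exact_mod_cast hr
    have hcont : ContinuousWithinAt J (bodyBoundary B) x :=
      continuousOn_areaDensity o hp hp' hp₀ hp₀' x hx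
    have hJx := hJpos x
    have hev : ∀ᶠ y in 𝓝[bodyBoundary B] x, J y < r * J x ∧ J x < r * J y := by
      refine (hcont.eventually_lt_const (by nlinarith : J x < r * J x)).and ?_
      exact (hcont.const_mul (r : ℝ)).eventually_const_lt (by nlinarith : J x < r * J x)
    obtain ⟨U₁, hU₁, h₁⟩ := mem_nhdsWithin_iff_exists_mem_nhds_inter.1 hev
    refine ⟨U ∩ U₀ ∩ U₁, inter_mem (inter_mem hU hU₀) hU₁, fun s hs hm => ?_⟩
    obtain ⟨-, ha, hb⟩ := h (s ∩ bodyBoundary B) (inter_subset_inter_left _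
      fun y hy => (hs hy).1.1)
    obtain ⟨-, ha₀, hb₀⟩ := h₀ (s ∩ bodyBoundary B) (inter_subset_inter_left _
      fun y hy => (hs hy).1.2)
    rw [← bodyArea_apply hpm] at ha hb
    rw [← bodyArea_apply hpm₀] at ha₀ hb₀
    have hsm : MeasurableSet (s ∩ bodyBoundary B) := hm.inter isClosed_bodyBoundary.measurableSet
    have hν₀ : ν₀ s = ν₀ (s ∩ bodyBoundary B) := by
      rw [bodyArea_apply hpm₀, bodyArea_apply hpm₀, inter_assoc, inter_self]
    have hG : ENNReal.ofReal (areaFactor o (chartDeriv p x x)) =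
        ENNReal.ofReal (J x) * ENNReal.ofReal (areaFactor o (chartDeriv p₀ x x)) := by
      rw [← ENNReal.ofReal_mul hJx.le, hJ, areaDensity,
        div_mul_cancel₀ _ (areaFactor_pos o hF₀).ne']
    have hmul : ∀ {a b : ℝ}, a < r * b → ENNReal.ofReal a ≤ r * ENNReal.ofReal b := by
      intro a b hab
      rw [← ENNReal.ofReal_coe_nnreal, ← ENNReal.ofReal_mul r.coe_nonneg]
      exact ENNReal.ofReal_le_ofReal hab.le
    have hI1 : ENNReal.ofReal (J x) * ν₀ s ≤
        r * ∫⁻ y in s ∩ bodyBoundary B, ENNReal.ofReal (J y) ∂ν₀ := by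
      rw [hν₀, ← setLIntegral_const, ← lintegral_const_mul' _ _ ENNReal.coe_ne_top]
      exact setLIntegral_mono' hsm fun y hy => hmul (h₁ ⟨(hs hy.1).2, hy.2⟩).2
    have hI2 : ∫⁻ y in s ∩ bodyBoundary B, ENNReal.ofReal (J y) ∂ν₀ ≤
        r * (ENNReal.ofReal (J x) * ν₀ s) := by
      rw [hν₀, ← mul_assoc, ← setLIntegral_const]
      exact setLIntegral_mono' hsm fun y hy => hmul (h₁ ⟨(hs hy.1).2, hy.2⟩).1
    rw [hdens s hm]
    set V := volume (planeInclusion ⁻¹' (extChartAt (𝓡∂ 3) x '' (s ∩ bodyBoundary B)))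
    set G₀ := ENNReal.ofReal (areaFactor o (chartDeriv p₀ x x))
    rw [hG] at ha hb
    constructor
    · calc ν s ≤ r ^ 2 * (ENNReal.ofReal (J x) * G₀ * V) := ha
        _ = r ^ 2 * (ENNReal.ofReal (J x) * (G₀ * V)) := by ring
        _ ≤ r ^ 2 * (ENNReal.ofReal (J x) * (r ^ 2 * ν₀ s)) := by gcongr
        _ = r ^ 4 * (ENNReal.ofReal (J x) * ν₀ s) := by ring
        _ ≤ r ^ 4 * (r * ∫⁻ y in s ∩ bodyBoundary B, ENNReal.ofReal (J y) ∂ν₀) := by gcongr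
        _ = _ := by ring
    · calc ∫⁻ y in s ∩ bodyBoundary B, ENNReal.ofReal (J y) ∂ν₀
          ≤ r * (ENNReal.ofReal (J x) * ν₀ s) := hI2
        _ ≤ r * (ENNReal.ofReal (J x) * (r ^ 2 * (G₀ * V))) := by gcongr
        _ = r ^ 3 * (ENNReal.ofReal (J x) * G₀ * V) := by ring
        _ ≤ r ^ 3 * (r ^ 2 * ν s) := by gcongr
        _ = _ := by ring
  refine le_antisymm ?_ ?_
  · refine Measure.le_of_forall_one_lt_smul 5 fun r hr => Measure.le_of_forall_nhds fun x => ?_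
    obtain ⟨U, hU, h⟩ := key r hr x
    exact ⟨U, hU, fun s hs hm => (h s hs hm).1⟩
  · refine Measure.le_of_forall_one_lt_smul 5 fun r hr => Measure.le_of_forall_nhds fun x => ?_
    obtain ⟨U, hU, h⟩ := key r hr x
    exact ⟨U, hU, fun s hs hm => (h s hs hm).2⟩

end AreaDensity

/-! ### Normals, mass densities and the pointwise Nanson formula. -/

section Stress

theorem AlternatingMap.apply_single_ne_zero {f : ℝ³ [⋀^Fin 3]→ₗ[ℝ] ℝ} (hf : f ≠ 0) :
    (f fun i => EuclideanSpace.single i (1 : ℝ)) ≠ 0 := by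
  intro h
  refine hf ?_
  rw [f.eq_smul_basis_det (EuclideanSpace.basisFun (Fin 3) ℝ).toBasis]
  have h2 : f (EuclideanSpace.basisFun (Fin 3) ℝ).toBasis = 0 := by
    rw [← h]
    congr 1
    ext i : 1
    simp
  rw [h2, zero_smul]

variable {B : Type*} [TopologicalSpace B] [ChartedSpace (EuclideanHalfSpace 3) B]
  [IsManifold (𝓡∂ 3) ∞ B]
  {E : Type*} [NormedAddCommGroup E] [InnerProductSpace ℝ E] {p p₀ : B → E}

/-- For the metric `p^* q` the tangent map is an isometry, so the defining conditions of the two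
normals are the same after unfolding, and uniqueness concludes. -/
theorem tangentF_bodyNormal [CompleteSpace E] (hp : ContMDiff (𝓡∂ 3) 𝓘(ℝ, E) ∞ p) {x : B}
    (hF : (chartDeriv p x x).IsInvertible) :
    tangentF p x (bodyNormal p x) = outerUnitNormal (euclideanMetric E) (chartDeriv p x x) := by
  have hT := chartDeriv_self hp x
  have hinj : Function.Injective (tangentF p x) := hT ▸ hF.bijective.1
  have hpos : ∀ u : TangentSpace (𝓡∂ 3) x, u ≠ 0 → 0 < bodyMetric p x u u := fun u hu =>
    euclideanMetric_pos (tangentF p x u) ((map_ne_zero_iff _ hinj).2 hu)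
  have h : IsOuterUnitNormal (V := TangentSpace (𝓡∂ 3) x) (bodyMetric p x)
      (ContinuousLinearMap.id ℝ (TangentSpace (𝓡∂ 3) x)) (bodyNormal p x) :=
    Classical.epsilon_spec (existsUnique_isOuterUnitNormal (V := TangentSpace (𝓡∂ 3) x)
      (bodyMetric p x) hpos (ContinuousLinearMap.id ℝ (TangentSpace (𝓡∂ 3) x))
      Function.bijective_id).exists
  have h2 : IsOuterUnitNormal (euclideanMetric E) (chartDeriv p x x)
      (tangentF p x (bodyNormal p x)) := by
    rw [hT]
    exact h
  have h3 := existsUnique_isOuterUnitNormal (euclideanMetric E) euclideanMetric_pos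
    (chartDeriv p x x) hF.bijective
  exact h3.unique h2 (Classical.epsilon_spec h3.exists)

theorem spaceNormal_apply (hp : ContMDiff (𝓡∂ 3) 𝓘(ℝ, E) ∞ p) (hinj : Function.Injective p)
    (x : B) : spaceNormal p (p x) = outerUnitNormal (euclideanMetric E) (chartDeriv p x x) := by
  rw [spaceNormal, hinj.extend_apply, chartDeriv_self hp]

/-- Both covectors are multiples of `-dy⁰ ∘ F⁻¹`: the left one divides it by the conormal norm of
`p₀`, and `q n` by that of `p`. -/
theorem tangentFInvStar_bodyMetric_bodyNormal [CompleteSpace E]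
    (hp : ContMDiff (𝓡∂ 3) 𝓘(ℝ, E) ∞ p) (hp₀ : ContMDiff (𝓡∂ 3) 𝓘(ℝ, E) ∞ p₀) {x : B}
    (hF : (chartDeriv p x x).IsInvertible) (hF₀ : (chartDeriv p₀ x x).IsInvertible) :
    tangentFInvStar p x (bodyMetric p₀ x (bodyNormal p₀ x)) =
      (‖conormal (chartDeriv p x x)‖ / ‖conormal (chartDeriv p₀ x x)‖) •
        euclideanMetric E (outerUnitNormal (euclideanMetric E) (chartDeriv p x x)) := by
  refine ContinuousLinearMap.ext fun v => ?_
  have h1 : tangentFInvStar p x (bodyMetric p₀ x (bodyNormal p₀ x)) v =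
      ⟪tangentF p₀ x (bodyNormal p₀ x), tangentF p₀ x (tangentFInv p x v)⟫_ℝ := rfl
  have h2 : tangentF p₀ x (tangentFInv p x v) =
      chartDeriv p₀ x x ((chartDeriv p x x).inverse v) := by
    rw [chartDeriv_self hp₀, chartDeriv_self hp]
    rfl
  have hm := norm_ne_zero_iff.2 (conormal_ne_zero hF)
  rw [h1, h2, tangentF_bodyNormal hp₀ hF₀, outerUnitNormal_eq hF₀, outerUnitNormal_eq hF,
    smul_apply, euclideanMetric_apply, real_inner_smul_left, real_inner_smul_left,
    inner_conormal hF₀, inner_conormal_left, smul_eq_mul]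
  field_simp

variable [Fact (Module.finrank ℝ E = 3)] {o : Orientation ℝ E (Fin 3)} {μ : VolumeForm B}

theorem massDensity_apply (hp : IsConfiguration o μ p) (x : B) :
    massDensity o μ p (p x) = (μ.toForm x fun i => EuclideanSpace.single i (1 : ℝ)) /
      o.volumeForm fun i => chartDeriv p x x (EuclideanSpace.single i 1) := by
  rw [massDensity, hp.isEmbedding.injective.extend_apply, chartDeriv_self hp.smooth]
  rfl

theorem volumeForm_mul_pos (hp : IsConfiguration o μ p) (x : B) :
    0 < (o.volumeForm fun i => chartDeriv p x x (EuclideanSpace.single i 1)) *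
      μ.toForm x fun i => EuclideanSpace.single i (1 : ℝ) := by
  have hne : (μ.toForm x fun i => EuclideanSpace.single i (1 : ℝ)) ≠ 0 :=
    AlternatingMap.apply_single_ne_zero (μ.ne_zero x)
  rw [chartDeriv_self hp.smooth]
  let e : Fin 3 → TangentSpace (𝓡∂ 3) x := fun i => EuclideanSpace.single i (1 : ℝ)
  change 0 < (o.volumeForm fun i => tangentF p x (e i)) * μ.toForm x e
  rcases lt_or_gt_of_ne hne with h | h
  -- The orientation hypothesis concerns positive frames only, so a negative coordinate frame is
  -- first made positive by exchanging two vectors.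
  · have h1 : μ.toForm x (e ∘ Equiv.swap 0 1) = -μ.toForm x e :=
      (μ.toForm x).map_swap e (by decide)
    have h2 : (o.volumeForm fun i => tangentF p x ((e ∘ Equiv.swap 0 1) i)) =
        -o.volumeForm fun i => tangentF p x (e i) :=
      o.volumeForm.map_swap (fun i => tangentF p x (e i)) (by decide)
    have h3 := hp.orientation x (e ∘ Equiv.swap 0 1) (by rw [h1]; exact neg_pos.2 h)
    rw [h2] at h3
    exact mul_pos_of_neg_of_neg (neg_pos.1 h3) h
  · exact mul_pos (hp.orientation x e h) h

/-- The mass form cancels. Both volumes have its sign, so their quotient is positive and absolute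
values may be inserted. -/
theorem massDensity_div (hp : IsConfiguration o μ p) (hp₀ : IsConfiguration o μ p₀) (x : B) :
    massDensity o μ p₀ (p₀ x) * (massDensity o μ p (p x))⁻¹ =
      |o.volumeForm fun i => chartDeriv p x x (EuclideanSpace.single i 1)| /
        |o.volumeForm fun i => chartDeriv p₀ x x (EuclideanSpace.single i 1)| := by
  rw [massDensity_apply hp, massDensity_apply hp₀]
  have h := volumeForm_mul_pos hp x
  have h₀ := volumeForm_mul_pos hp₀ x
  set m := μ.toForm x fun i => EuclideanSpace.single i (1 : ℝ)
  set a := o.volumeForm fun i => chartDeriv p x x (EuclideanSpace.single i 1)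
  set b := o.volumeForm fun i => chartDeriv p₀ x x (EuclideanSpace.single i 1)
  have hm : m ≠ 0 := right_ne_zero_of_mul h.ne'
  have hab : 0 < a / b := by
    rw [← mul_div_mul_right a b hm]
    exact div_pos h h₀
  rw [← abs_div, abs_of_pos hab, inv_div, div_mul_div_comm, mul_comm b m,
    mul_div_mul_left _ _ hm]

theorem firstPiolaKirchhoff_bodyNormal [CompleteSpace E] (hp : IsConfiguration o μ p)
    (hp₀ : IsConfiguration o μ p₀) (σ : E → (E →L[ℝ] ℝ) →L[ℝ] E) (x : B) :
    firstPiolaKirchhoff o μ p₀ p σ x (bodyNormal p₀ x) = areaDensity o p p₀ x •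
      σ (p x) (euclideanMetric E (outerUnitNormal (euclideanMetric E) (chartDeriv p x x))) := by
  have hF := isInvertible_chartDeriv_self hp.smooth hp.immersion x
  have hF₀ := isInvertible_chartDeriv_self hp₀.smooth hp₀.immersion x
  have h1 : firstPiolaKirchhoff o μ p₀ p σ x (bodyNormal p₀ x) =
      massDensity o μ p₀ (p₀ x) • (massDensity o μ p (p x))⁻¹ •
        σ (p x) (tangentFInvStar p x (bodyMetric p₀ x (bodyNormal p₀ x))) := rfl
  rw [h1, tangentFInvStar_bodyMetric_bodyNormal hp.smooth hp₀.smooth hF hF₀, map_smul, smul_smul,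
    smul_smul, massDensity_div hp hp₀, areaDensity, areaFactor, areaFactor, div_mul_div_comm]

theorem firstPiolaKirchhoff_eq (hp : IsConfiguration o μ p) (σ : E → (E →L[ℝ] ℝ) →L[ℝ] E)
    (x : B) : firstPiolaKirchhoff o μ p₀ p σ x =
      massDensity o μ p₀ (p₀ x) • (tangentF p x).comp
        ((pullbackContravariant p (kirchhoffStress o μ p σ) x).comp (bodyMetric p₀ x)) := by
  have hF := isInvertible_chartDeriv_self hp.smooth hp.immersion x
  have h (u : E) : tangentF p x (tangentFInv p x u) = u := by
    have h1 : tangentF p x (tangentFInv p x u) =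
        chartDeriv p x x ((chartDeriv p x x).inverse u) := by
      rw [chartDeriv_self hp.smooth]
      rfl
    rw [h1, hF.self_apply_inverse]
  refine ContinuousLinearMap.ext fun v => ?_
  exact congrArg (massDensity o μ p₀ (p₀ x) • ·) (h _).symm

theorem IsConfiguration.measurableEmbedding [CompactSpace B] [MeasurableSpace B] [BorelSpace B]
    [MeasurableSpace E] [BorelSpace E] (hp : IsConfiguration o μ p) : MeasurableEmbedding p :=
  (hp.isEmbedding.continuous.isClosedEmbedding hp.isEmbedding.injective).measurableEmbedding

end Stress

/-! ### Transfer to the body and the equality of the integrals. -/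

theorem map_bodyArea {B : Type*} [TopologicalSpace B] [ChartedSpace (EuclideanHalfSpace 3) B]
    [MeasurableSpace B] {E : Type*} [NormedAddCommGroup E] [MeasurableSpace E] [BorelSpace E]
    {p : B → E} (hp : MeasurableEmbedding p) : (bodyArea p).map p = spaceArea p := by
  rw [bodyArea, hp.map_comap, spaceArea, Measure.restrict_restrict hp.measurableSet_range,
    inter_eq_self_of_subset_right (image_subset_range _ _)]

theorem mainTheorem5
    {E : Type*} [NormedAddCommGroup E] [InnerProductSpace ℝ E] [Fact (Module.finrank ℝ E = 3)]
    [MeasurableSpace E] [BorelSpace E] (o : Orientation ℝ E (Fin 3))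
    {B : Type*} [TopologicalSpace B] [ChartedSpace (EuclideanHalfSpace 3) B]
    [IsManifold (𝓡∂ 3) ∞ B] [CompactSpace B] [T2Space B] [MeasurableSpace B] [BorelSpace B]
    (μ : VolumeForm B) (p₀ p : B → E)
    (hp₀ : IsConfiguration o μ p₀) (hp : IsConfiguration o μ p)
    (σ : E → (E →L[ℝ] ℝ) →L[ℝ] E) (hσ : ContinuousOn σ (Set.range p))
    (hσ_symm : ∀ y ∈ Set.range p, ∀ α β : E →L[ℝ] ℝ, α (σ y β) = β (σ y α)) :
    (∀ x : B, firstPiolaKirchhoff o μ p₀ p σ x =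
      massDensity o μ p₀ (p₀ x) • (tangentF p x).comp
        ((pullbackContravariant p (kirchhoffStress o μ p σ) x).comp (bodyMetric p₀ x))) ∧
    ∀ δp : B → E, ContMDiff (𝓡∂ 3) 𝓘(ℝ, E) ∞ δp →
      ∀ w : E → E, (∀ x, w (p x) = δp x) →
        MeasureTheory.Integrable
          (fun y => ⟪σ y (euclideanMetric E (spaceNormal p y)), w y⟫_ℝ) (spaceArea p) ∧
        MeasureTheory.Integrable
          (fun x => ⟪firstPiolaKirchhoff o μ p₀ p σ x (bodyNormal p₀ x), δp x⟫_ℝ)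
          (bodyArea p₀) ∧
        ∫ y, ⟪σ y (euclideanMetric E (spaceNormal p y)), w y⟫_ℝ ∂(spaceArea p) =
          ∫ x, ⟪firstPiolaKirchhoff o μ p₀ p σ x (bodyNormal p₀ x), δp x⟫_ℝ
            ∂(bodyArea p₀) := by
  refine ⟨firstPiolaKirchhoff_eq hp σ, fun δp hδp w hw => ?_⟩
  have : FiniteDimensional ℝ E := .of_fact_finrank_eq_succ 2
  have : CompleteSpace E := FiniteDimensional.complete ℝ E
  have hpm := hp.measurableEmbedding
  have hpm₀ := hp₀.measurableEmbedding
  have := isFiniteMeasure_bodyArea hpm hp.smooth hp.immersion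
  have := isFiniteMeasure_bodyArea hpm₀ hp₀.smooth hp₀.immersion
  set g : B → ℝ := fun x => ⟪σ (p x) (euclideanMetric E
    (outerUnitNormal (euclideanMetric E) (chartDeriv p x x))), δp x⟫_ℝ with hg
  -- With compactness of the boundary and finiteness of the areas, this continuity yields both
  -- integrability claims.
  have hgc : ContinuousOn g (bodyBoundary B) := by
    have h1 : Continuous (σ ∘ p) := hσ.comp_continuous hp.smooth.continuous mem_range_self
    exact (h1.continuousOn.clm_apply ((euclideanMetric E).continuous.comp_continuousOn
      (continuousOn_outerUnitNormal hp.smooth hp.immersion))).inner hδp.continuous.continuousOn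
  have hJc := continuousOn_areaDensity o hp.smooth hp.immersion hp₀.smooth hp₀.immersion
  have hJpos := areaDensity_pos o hp.smooth hp.immersion hp₀.smooth hp₀.immersion
  have hleft : (fun y => ⟪σ y (euclideanMetric E (spaceNormal p y)), w y⟫_ℝ) ∘ p = g := by
    ext x
    rw [Function.comp_apply, spaceNormal_apply hp.smooth hp.isEmbedding.injective, hw]
  have hright : (fun x => ⟪firstPiolaKirchhoff o μ p₀ p σ x (bodyNormal p₀ x), δp x⟫_ℝ) =
      fun x => areaDensity o p p₀ x • g x := by
    ext x
    rw [firstPiolaKirchhoff_bodyNormal hp hp₀, real_inner_smul_left, smul_eq_mul]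
  have hcompact : IsCompact (bodyBoundary B) := isClosed_bodyBoundary.isCompact
  refine ⟨?_, ?_, ?_⟩
  · rw [← map_bodyArea hpm, hpm.integrable_map_iff, hleft, ← bodyArea_restrict hpm]
    exact hgc.integrableOn_compact hcompact
  · rw [hright, ← bodyArea_restrict hpm₀]
    exact (hJc.smul hgc).integrableOn_compact hcompact
  -- Continuity of the density is known on the boundary only, which suffices because the measure is
  -- carried by it.
  · have hJm : AEMeasurable (areaDensity o p p₀) (bodyArea p₀) := by
      rw [← bodyArea_restrict hpm₀]
      exact hJc.aemeasurable isClosed_bodyBoundary.measurableSet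
    rw [← map_bodyArea hpm, hpm.integral_map, hright]
    change ∫ x, ((fun y => ⟪σ y (euclideanMetric E (spaceNormal p y)), w y⟫_ℝ) ∘ p) x
      ∂(bodyArea p) = _
    rw [hleft, bodyArea_eq_withDensity o hpm hp.smooth hp.immersion hpm₀ hp₀.smooth hp₀.immersion,
      integral_withDensity_eq_integral_toReal_smul₀ hJm.ennreal_ofReal
        (Eventually.of_forall fun _ => ENNReal.ofReal_lt_top)]
    refine integral_congr_ae (Eventually.of_forall fun x => ?_)
    simp only [ENNReal.toReal_ofReal (hJpos x).le]

end
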